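/- Let $n\in\mathbb N$, $a<b$, $I=[a,b]$, and let $f:\mathbb R^n\times I\to\mathbb R^n$ be continuous and continuously differentiable in its first argument (that is, $D_uf$ exists and is continuous on $\mathbb R^n\times I$). Let $I_\xi=[-\sqrt3,\sqrt3]$, $\bar\mu=\frac{a+b}{2}$, $\sigma=\frac{b-a}{2\sqrt3}$ (the mean and the standard deviation of the uniform distribution on $[a,b]$), so that $z\mapsto\bar\mu+\sigma z$ maps $I_\xi$ onto $I$, and put $\mathcal F(u)(z)=f(u(z),\bar\mu+\sigma z)$. All inner products and norms $\langle\cdot,\cdot\rangle_{L^2}$, $\|\cdot\|_{L^2}$ are those of $L^2(I_\xi;\mathbb R^n)$ or $L^2(I_\xi)$ with Lebesgue measure and the Euclidean norm on $\mathbb R^n$. Let $(\Phi_k)_{k\ge0}$ be real polynomials with $\deg\Phi_k=k$ that are pairwise orthogonal in $L^2(I_\xi)$ (scaled Legendre polynomials). For $\hat u=(\hat u_0,\dots,\hat u_N)\in(\mathbb R^n)^{N+1}$ let $\mathcal I_n(\hat u)=\sum_{j=0}^N\hat u_j\Phi_j$, and define $F_N:(\mathbb R^n)^{N+1}\to(\mathbb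 R^n)^{N+1}$ (the PCE-Galerkin system of degree $N$) by $$F_N(\hat u)_i=\frac{\langle\mathcal F(\mathcal I_n(\hat u)),\Phi_i\rangle_{L^2}}{\|\Phi_i\|_{L^2}^2},\qquad i=0,\dots,N,$$ where $\langle v,\Phi_i\rangle_{L^2}$ is taken componentwise for vector-valued $v$. **Theorem (Convergence).** Let $\bar u:I_\xi\to\mathbb R^n$ be continuous with $f(\bar u(z),\bar\mu+\sigma z)=0$ for all $z\in I_\xi$ (a solution branch). Suppose that $\bar u\in H^s(I_\xi;\mathbb R^n)$ for some real $s>1$ and that there is $\lambda_{\min}>0$ with $$\langle D_uf(\bar u(z),\bar\mu+\sigma z)w,w\rangle\ge\lambda_{\min}\|w\|^2\qquad\text{for all }z\in I_\xi,\ w\in\mathbb R^n.$$ Let $u_{LS,N}=\sum_{i=0}^N\frac{\langle\bar u,\Phi_i\rangle_{L^2}}{\|\Phi_i\|_{L^2}^2}\Phi_i$ be the least-squares approximation of $\bar u$ of degree at most $N$, and $E(N)=\|\mathcal F(u_{LS,N})\|_{L^2}$ its residual. Then there are $N_{\mathrm{conv}}\in\mathbb N$ and $\varepsilon>0$ such that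 for every $N\ge N_{\mathrm{conv}}$ the system $F_N(\hat u)=0$ has exactly one solution $\hat u_N$ whose polynomial $u_N=\mathcal I_n(\hat u_N)$ lies in the neighbourhood $\{u:\ \|u(z)-u_{LS,N}(z)\|<\varepsilon\ \text{for all }z\in I_\xi\}$ of $u_{LS,N}$. Moreover, as $N\to\infty$, the error $\|\bar u-u_N\|_{L^2}$ is of the same order as the residual, $$\|\bar u-u_N\|_{L^2}=\Theta(E(N)),\qquad E(N)=\mathcal O(N^{-s}),$$ and in particular $\|\bar u-u_N\|_{L^2}=\mathcal O(N^{-s})$. -/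

import Mathlib

open MeasureTheory Set Filter Asymptotics Polynomial

namespace PCGalerkin

noncomputable section

/-- The state space `ℝⁿ` with its Euclidean norm. -/
abbrev State (n : ℕ) : Type := EuclideanSpace ℝ (Fin n)

/-- The interval `I_ξ = [-√3, √3]`: the support of a uniformly distributed random variable with
mean `0` and variance `1`. -/
def Ixi : Set ℝ := Icc (-√3) √3

/-- The parameter `μ̄ + σ z`, where `μ̄ = (a + b) / 2` and `σ = (b - a) / (2 √3)` are the mean and
the standard deviation of the uniform distribution on `[a, b]`.
It maps `I_ξ` affinely onto `[a, b]`. -/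
def param (a b z : ℝ) : ℝ := (a + b) / 2 + (b - a) / (2 * √3) * z

/-- The `L²(I_ξ; ℝⁿ)` norm (used for functions that are continuous on `I_ξ`). -/
def l2Norm {n : ℕ} (v : ℝ → State n) : ℝ := √(∫ z in Ixi, ‖v z‖ ^ 2)

/-- `g` is the `k`-th weak derivative of `u` on the interior of `I_ξ`. -/
def HasWeakDeriv {n : ℕ} (k : ℕ) (u g : ℝ → State n) : Prop :=
  ∀ φ : ℝ → ℝ, ContDiff ℝ (⊤ : ℕ∞) φ → HasCompactSupport φ → tsupport φ ⊆ interior Ixi →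
    ∫ z in Ixi, iteratedDeriv k φ z • u z = (-1 : ℝ) ^ k • ∫ z in Ixi, φ z • g z

/-- The (squared) Gagliardo seminorm of order `θ` on `I_ξ`. -/
def gagliardo {n : ℕ} (θ : ℝ) (g : ℝ → State n) : ENNReal :=
  ∫⁻ x in Ixi, ∫⁻ y in Ixi, ENNReal.ofReal (‖g x - g y‖ ^ 2 / |x - y| ^ (1 + 2 * θ))

/-- Membership in the Sobolev space `H^s(I_ξ; ℝⁿ)` of real order `s ≥ 0` (Sobolev–Slobodeckij
definition): with `m = ⌊s⌋`, the weak derivatives of order `0, …, m` exist and are in `L²`, and if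
`s` is not an integer, the `m`-th one has finite Gagliardo seminorm of order `s - m`. -/
def MemHs {n : ℕ} (s : ℝ) (u : ℝ → State n) : Prop :=
  ∃ g : ℕ → ℝ → State n,
    (∀ k ≤ ⌊s⌋₊, HasWeakDeriv k u (g k) ∧ MemLp (g k) 2 (volume.restrict Ixi)) ∧
    ((⌊s⌋₊ : ℝ) ≠ s → gagliardo (s - ⌊s⌋₊) (g ⌊s⌋₊) < ⊤)

/-- A polynomial chaos basis for the uniform law on `I_ξ`: `Φ k` has degree `k`, and the `Φ k` are
pairwise orthogonal in `L²(I_ξ)`. These are the Legendre polynomials transported to `I_ξ`, with an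
arbitrary normalization. -/
structure IsPCBasis (Φ : ℕ → ℝ[X]) : Prop where
  degree_eq : ∀ k, (Φ k).degree = k
  orthogonal : ∀ i j, i ≠ j → ∫ z in Ixi, (Φ i).eval z * (Φ j).eval z = 0

/-- The polynomial `∑_{j ≤ N} û_j Φ_j` with coefficient vector `û`. -/
def toPoly {n : ℕ} (Φ : ℕ → ℝ[X]) {N : ℕ} (c : Fin (N + 1) → State n) (z : ℝ) : State n :=
  ∑ j : Fin (N + 1), (Φ j).eval z • c j

/-- The coefficients `⟨v, Φ_i⟩ / ‖Φ_i‖²`, `i ≤ N`, of the `L²`-orthogonal projection of `v` on the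
polynomials of degree at most `N`. -/
def projCoeff {n : ℕ} (Φ : ℕ → ℝ[X]) (N : ℕ) (v : ℝ → State n) (i : Fin (N + 1)) : State n :=
  (∫ z in Ixi, (Φ i).eval z ^ 2)⁻¹ • ∫ z in Ixi, (Φ i).eval z • v z

/-- The least-squares (best `L²`) polynomial approximation of degree at most `N` of `v`. -/
def leastSquares {n : ℕ} (Φ : ℕ → ℝ[X]) (N : ℕ) (v : ℝ → State n) : ℝ → State n :=
  toPoly Φ (projCoeff Φ N v)

/-- The re-parametrized Nemytskii operator `𝓕(u)(z) = f(u(z), μ̄ + σ z)`. -/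
def nemytskii {n : ℕ} (f : State n → ℝ → State n) (a b : ℝ) (u : ℝ → State n) (z : ℝ) : State n :=
  f (u z) (param a b z)

/-- The Galerkin map `F_N`, in coefficient space:
`F_N(û)_i = ⟨𝓕(∑_j û_j Φ_j), Φ_i⟩ / ‖Φ_i‖²`. -/
def galerkin {n : ℕ} (f : State n → ℝ → State n) (a b : ℝ) (Φ : ℕ → ℝ[X]) {N : ℕ}
    (c : Fin (N + 1) → State n) : Fin (N + 1) → State n :=
  projCoeff Φ N (nemytskii f a b (toPoly Φ c))

end

end PCGalerkin

open PCGalerkin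

/-!
# Convergence of the PCE-Galerkin method along a strictly monotone branch

After normalization the chaos basis consists of the orthonormal Legendre polynomials `φ k` on
`I_ξ = [-√3, √3]` (`IsPCBasis.exists_orthonormal`). The proof combines a quantitative
approximation theorem with a contraction argument.

*Approximation.* Orthogonality alone forces Legendre's equation
`((3 - x²) φ k')' = -k (k + 1) φ k` (`IsOrthonormalBasis.legendreOp_eq`). It gives the bound
`φ k ² ≤ 2 k + 1`, hence the inverse inequality `sup |p| ≤ (N + 1) ‖p‖` for polynomials of degree
`N`, and it shows that the `L²` distance of `w` to these polynomials is at most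
`√3 / (N + 1) ‖w'‖`. Subtracting a primitive of a good approximation of `w'` turns the latter
into a recursion (`IsOrthonormalBasis.l2Norm_sub_succ_le`), which reduces the rate `N⁻ˢ` for a
function in `H^s` to the rate `N^(-θ)`, `θ = s - ⌊s⌋`, for its highest derivative. A function of
finite Gagliardo seminorm is split by moving averages at scale `1 / (N + 1)` into a small part and
a part with controlled derivative (`exists_smoothing`), which gives that rate. Since `s > 1`, the
inverse inequality, applied to the differences of the projections of degrees `2 ^ j N`, yields
uniform convergence as well (`IsOrthonormalBasis.exists_forall_norm_sub_lt`).

Derivatives enter only through the identity `∫ ((3 - x²) p)' w = -∫ (3 - x²) p w'` for polynomials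
`p` (`HasPolyWeakDeriv`), so no pointwise representatives of weak derivatives are needed.

*Galerkin equations.* By compactness the nonlinearity is Lipschitz and strongly monotone in
a uniform tube around the branch (`exists_lipschitz_monotone`), and for large `N` the tube contains
a uniform neighbourhood of the least squares approximation `u_LS`. Restricted to polynomials with
the `L²` norm, the Galerkin map is then Lipschitz and strongly monotone on the ball around `u_LS`
of radius `r` proportional to `1 / (N + 1)`, with constants independent of `N`. The residual at
the centre is `O(N⁻ˢ) = o(r)`, so `x ↦ x - τ G x` is a contraction of this ball
(`exists_zero_of_strongly_monotone`). Monotonicity gives uniqueness and, together with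
the best approximation property of `u_LS`, the equivalence of error and residual.
-/

namespace PCGalerkin

variable {n N : ℕ}

/-! ### The space `L²(I_ξ; ℝⁿ)` -/

lemma isCompact_Ixi : IsCompact Ixi := isCompact_Icc

lemma measurableSet_Ixi : MeasurableSet Ixi := measurableSet_Icc

lemma sqrt_three_pos : (0 : ℝ) < √3 := by positivity

lemma mem_Ixi {z : ℝ} : z ∈ Ixi ↔ -√3 ≤ z ∧ z ≤ √3 := Iff.rfl

instance : IsFiniteMeasure (volume.restrict Ixi) :=
  ⟨by simpa using isCompact_Ixi.measure_lt_top⟩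

lemma memLp_of_continuousOn {v : ℝ → State n} (hv : ContinuousOn v Ixi) :
    MemLp v 2 (volume.restrict Ixi) := by
  obtain ⟨C, hC⟩ := isCompact_Ixi.exists_bound_of_continuousOn hv
  refine MemLp.of_bound (hv.aestronglyMeasurable measurableSet_Ixi) C ?_
  filter_upwards [ae_restrict_mem measurableSet_Ixi] with x hx using hC x hx

lemma l2Norm_nonneg (v : ℝ → State n) : 0 ≤ l2Norm v := Real.sqrt_nonneg _

lemma l2Norm_sq (v : ℝ → State n) : l2Norm v ^ 2 = ∫ z in Ixi, ‖v z‖ ^ 2 :=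
  Real.sq_sqrt (integral_nonneg fun _ => by positivity)

lemma l2Norm_congr_ae {v w : ℝ → State n} (h : v =ᵐ[volume.restrict Ixi] w) :
    l2Norm v = l2Norm w := by
  unfold l2Norm
  congr 1
  refine integral_congr_ae ?_
  filter_upwards [h] with x hx using by rw [hx]

lemma l2Norm_eq_norm_toLp {v : ℝ → State n} (hv : MemLp v 2 (volume.restrict Ixi)) :
    l2Norm v = ‖hv.toLp v‖ := by
  have h : ‖hv.toLp v‖ ^ 2 = l2Norm v ^ 2 := by
    rw [l2Norm_sq, ← real_inner_self_eq_norm_sq, L2.inner_def]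
    refine integral_congr_ae ?_
    filter_upwards [hv.coeFn_toLp] with x hx
    rw [hx, real_inner_self_eq_norm_sq]
  exact ((pow_left_inj₀ (norm_nonneg _) (l2Norm_nonneg v) two_ne_zero).1 h).symm

lemma l2Norm_add_le {v w : ℝ → State n} (hv : MemLp v 2 (volume.restrict Ixi))
    (hw : MemLp w 2 (volume.restrict Ixi)) :
    l2Norm (fun z => v z + w z) ≤ l2Norm v + l2Norm w := by
  have h : l2Norm (fun z => v z + w z) = _ := l2Norm_eq_norm_toLp (hv.add hw)
  rw [h, l2Norm_eq_norm_toLp hv, l2Norm_eq_norm_toLp hw, MemLp.toLp_add]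
  exact norm_add_le _ _

lemma l2Norm_sub_comm (v w : ℝ → State n) :
    l2Norm (fun z => v z - w z) = l2Norm (fun z => w z - v z) := by
  simp_rw [l2Norm, norm_sub_rev]

lemma l2Norm_sub_le_add {u v w : ℝ → State n} (hu : MemLp u 2 (volume.restrict Ixi))
    (hv : MemLp v 2 (volume.restrict Ixi)) (hw : MemLp w 2 (volume.restrict Ixi)) :
    l2Norm (fun z => u z - w z) ≤
      l2Norm (fun z => u z - v z) + l2Norm (fun z => v z - w z) := by
  have h := l2Norm_add_le (v := fun z => u z - v z) (w := fun z => v z - w z)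
    (hu.sub hv) (hv.sub hw)
  simpa using h

lemma integrable_inner {v w : ℝ → State n} (hv : MemLp v 2 (volume.restrict Ixi))
    (hw : MemLp w 2 (volume.restrict Ixi)) :
    IntegrableOn (fun z => inner ℝ (v z) (w z)) Ixi := by
  refine (L2.integrable_inner (𝕜 := ℝ) (hv.toLp v) (hw.toLp w)).congr ?_
  filter_upwards [hv.coeFn_toLp, hw.coeFn_toLp] with x hx hx'
  rw [hx, hx']

lemma integral_inner_le {v w : ℝ → State n} (hv : MemLp v 2 (volume.restrict Ixi))
    (hw : MemLp w 2 (volume.restrict Ixi)) :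
    ∫ z in Ixi, inner ℝ (v z) (w z) ≤ l2Norm v * l2Norm w := by
  have h : ∫ z in Ixi, inner ℝ (v z) (w z) = inner ℝ (hv.toLp v) (hw.toLp w) := by
    rw [L2.inner_def]
    refine integral_congr_ae ?_
    filter_upwards [hv.coeFn_toLp, hw.coeFn_toLp] with x hx hx'
    rw [hx, hx']
  rw [h, l2Norm_eq_norm_toLp hv, l2Norm_eq_norm_toLp hw]
  exact real_inner_le_norm _ _

lemma integrable_norm_sq {v : ℝ → State n} (hv : MemLp v 2 (volume.restrict Ixi)) :
    IntegrableOn (fun z => ‖v z‖ ^ 2) Ixi := by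
  simpa using integrable_inner hv hv

lemma l2Norm_le_mul {v w : ℝ → State n} {C : ℝ} (hC : 0 ≤ C)
    (hw : MemLp w 2 (volume.restrict Ixi)) (h : ∀ z ∈ Ixi, ‖v z‖ ≤ C * ‖w z‖) :
    l2Norm v ≤ C * l2Norm w := by
  refine Real.sqrt_le_iff.2 ⟨mul_nonneg hC (l2Norm_nonneg _), ?_⟩
  rw [mul_pow, l2Norm_sq, ← integral_const_mul]
  refine integral_mono_of_nonneg (ae_of_all _ fun _ => by positivity)
    ((integrable_norm_sq hw).const_mul _) ?_
  filter_upwards [ae_restrict_mem measurableSet_Ixi] with z hz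
  have := pow_le_pow_left₀ (norm_nonneg _) (h z hz) 2
  rwa [mul_pow] at this

lemma l2Norm_le_of_forall_norm_le {v : ℝ → State n} {C : ℝ} (hC : 0 ≤ C)
    (h : ∀ z ∈ Ixi, ‖v z‖ ≤ C) : l2Norm v ≤ 2 * C := by
  have h4 : ∫ _z in Ixi, C ^ 2 = 2 * √3 * C ^ 2 := by
    simp only [setIntegral_const, Ixi, smul_eq_mul]
    rw [Measure.real, Real.volume_Icc, ENNReal.toReal_ofReal (by linarith [sqrt_three_pos])]
    ring
  refine Real.sqrt_le_iff.2 ⟨by positivity, ?_⟩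
  calc ∫ z in Ixi, ‖v z‖ ^ 2 ≤ ∫ _z in Ixi, C ^ 2 := by
        refine integral_mono_of_nonneg (ae_of_all _ fun _ => by positivity)
          (integrable_const _) ?_
        filter_upwards [ae_restrict_mem measurableSet_Ixi] with z hz
        exact pow_le_pow_left₀ (norm_nonneg _) (h z hz) 2
    _ = 2 * √3 * C ^ 2 := h4
    _ ≤ (2 * C) ^ 2 := by
        have : √3 ≤ 2 := Real.sqrt_le_iff.2 ⟨by norm_num, by norm_num⟩
        nlinarith [sq_nonneg C]

lemma eqOn_of_l2Norm_sub_eq_zero {v w : ℝ → State n} (hv : ContinuousOn v Ixi)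
    (hw : ContinuousOn w Ixi) (h : l2Norm (fun z => v z - w z) = 0) : EqOn v w Ixi := by
  have h2 : ∫ z in Ixi, ‖v z - w z‖ ^ 2 = 0 := by
    rw [← l2Norm_sq (fun z => v z - w z), h]; norm_num
  have hi : IntegrableOn (fun z => ‖v z - w z‖ ^ 2) Ixi :=
    integrable_norm_sq (memLp_of_continuousOn (hv.sub hw))
  rw [integral_eq_zero_iff_of_nonneg (fun _ => by positivity) hi] at h2
  have hae : v =ᵐ[volume.restrict Ixi] w := by
    filter_upwards [h2] with z hz
    simpa [sub_eq_zero] using hz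
  exact Measure.eqOn_Icc_of_ae_eq volume (by linarith [sqrt_three_pos]) hae hv hw

/-! ### Orthonormal Legendre polynomials -/

lemma integrable_eval (p : ℝ[X]) : IntegrableOn (fun z => p.eval z) Ixi :=
  p.continuous.continuousOn.integrableOn_compact isCompact_Ixi

/-- Integration over `I_ξ` as a linear functional on polynomials. -/
noncomputable def polyIntegral : ℝ[X] →ₗ[ℝ] ℝ where
  toFun p := ∫ z in Ixi, p.eval z
  map_add' p q := by
    simp only [eval_add]
    exact integral_add (integrable_eval p) (integrable_eval q)
  map_smul' c p := by simp [integral_const_mul]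

lemma polyIntegral_apply (p : ℝ[X]) : polyIntegral p = ∫ z in Ixi, p.eval z := rfl

lemma polyIntegral_derivative (p : ℝ[X]) :
    polyIntegral (derivative p) = p.eval √3 - p.eval (-√3) := by
  rw [polyIntegral_apply, Ixi, integral_Icc_eq_integral_Ioc,
    ← intervalIntegral.integral_of_le (by linarith [sqrt_three_pos])]
  exact intervalIntegral.integral_eq_sub_of_hasDerivAt (fun x _ => p.hasDerivAt x)
    ((derivative p).continuous.intervalIntegrable _ _)

lemma eq_zero_of_polyIntegral_mul_self {p : ℝ[X]} (h : polyIntegral (p * p) = 0) : p = 0 := by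
  rw [polyIntegral_apply, integral_eq_zero_iff_of_nonneg
    (fun z => by simpa using mul_self_nonneg (p.eval z)) (integrable_eval _)] at h
  have hae : (fun z => p.eval z) =ᵐ[volume.restrict Ixi] fun z => (0 : ℝ[X]).eval z := by
    filter_upwards [h] with z hz
    simpa using hz
  have hon := Measure.eqOn_Icc_of_ae_eq volume (by linarith [sqrt_three_pos]) hae
    p.continuous.continuousOn (0 : ℝ[X]).continuous.continuousOn
  exact eq_of_infinite_eval_eq p 0
    ((Icc_infinite (by linarith [sqrt_three_pos] : -√3 < √3)).mono hon)

/-- The Legendre differential operator `p ↦ ((3 - x²) p')'` on `I_ξ`. -/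
noncomputable def legendreOp (p : ℝ[X]) : ℝ[X] := derivative ((C 3 - X ^ 2) * derivative p)

/-- Integration by parts: the boundary terms vanish because of the weight `3 - x²`. -/
lemma polyIntegral_weight_derivative_mul (p q : ℝ[X]) :
    polyIntegral (derivative ((C 3 - X ^ 2) * p) * q) =
      -polyIntegral ((C 3 - X ^ 2) * p * derivative q) := by
  have h : polyIntegral (derivative ((C 3 - X ^ 2) * p * q)) = 0 := by
    rw [polyIntegral_derivative]
    simp
  rw [derivative_mul, map_add] at h
  linarith

lemma polyIntegral_legendreOp_mul_comm (p q : ℝ[X]) :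
    polyIntegral (legendreOp p * q) = polyIntegral (p * legendreOp q) := by
  rw [mul_comm p, legendreOp, legendreOp, polyIntegral_weight_derivative_mul,
    polyIntegral_weight_derivative_mul]
  congr 2
  ring

lemma coeff_legendreOp {p : ℝ[X]} {k m : ℕ} (hp : p.degree ≤ k) (hm : k ≤ m) :
    (legendreOp p).coeff m = -(m * (m + 1) : ℝ) * p.coeff m := by
  have h0 : ∀ i, k < i → p.coeff i = 0 := fun i hi =>
    coeff_eq_zero_of_degree_lt (hp.trans_lt (by exact_mod_cast hi))
  rw [legendreOp, coeff_derivative, sub_mul, coeff_sub, coeff_C_mul, coeff_derivative,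
    h0 (m + 1 + 1) (by omega)]
  rcases m with _ | m
  · rw [mul_comm (X ^ 2) (derivative p), coeff_mul_X_pow']
    simp
  · rw [show m + 1 + 1 = m + 2 from rfl, mul_comm (X ^ 2) (derivative p), coeff_mul_X_pow,
      coeff_derivative]
    push_cast
    ring

lemma degree_legendreOp_le {p : ℝ[X]} {k : ℕ} (hp : p.degree ≤ k) :
    (legendreOp p).degree ≤ k := by
  rw [degree_le_iff_coeff_zero]
  intro m hm
  have hm' : k < m := by exact_mod_cast hm
  rw [coeff_legendreOp hp hm'.le, coeff_eq_zero_of_degree_lt (hp.trans_lt hm), mul_zero]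

/-- A polynomial chaos basis normalized in `L²(I_ξ)`: the Legendre polynomials up to sign. -/
structure IsOrthonormalBasis (φ : ℕ → ℝ[X]) : Prop where
  degree_eq : ∀ k, (φ k).degree = k
  integral_mul : ∀ i j, polyIntegral (φ i * φ j) = if i = j then 1 else 0

namespace IsOrthonormalBasis

variable {φ : ℕ → ℝ[X]} (hφ : IsOrthonormalBasis φ)
include hφ

lemma coeff_ne_zero (k : ℕ) : (φ k).coeff k ≠ 0 := by
  intro h
  have h1 := hφ.degree_eq k
  have : (φ k).natDegree = k := natDegree_eq_of_degree_eq_some h1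
  have h2 : (φ k).leadingCoeff = 0 := by rw [leadingCoeff, this, h]
  rw [leadingCoeff_eq_zero] at h2
  rw [h2, degree_zero] at h1
  simp at h1

/-- `φ 0, …, φ N` span the polynomials of degree at most `N`. -/
lemma exists_eq_sum (N : ℕ) : ∀ p : ℝ[X], p.degree ≤ N →
    ∃ a : ℕ → ℝ, p = ∑ j ∈ Finset.range (N + 1), C (a j) * φ j := by
  suffices h : ∀ N : ℕ, ∀ p : ℝ[X], p.degree < N →
      ∃ a : ℕ → ℝ, p = ∑ j ∈ Finset.range N, C (a j) * φ j from
    fun p hp => h (N + 1) p (hp.trans_lt (by exact_mod_cast Nat.lt_succ_self N))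
  intro N
  induction N with
  | zero =>
    intro p hp
    refine ⟨0, ?_⟩
    have : p = 0 := by
      rw [← degree_eq_bot]
      exact Nat.WithBot.lt_zero_iff.1 (by simpa using hp)
    simp [this]
  | succ N ih =>
    intro p hp
    set b := p.coeff N / (φ N).coeff N with hb
    obtain ⟨a, ha⟩ := ih (p - C b * φ N) (by
      rw [degree_lt_iff_coeff_zero]
      intro m hm
      rcases hm.eq_or_lt with rfl | hm
      · rw [coeff_sub, coeff_C_mul, hb, div_mul_cancel₀ _ (hφ.coeff_ne_zero _), sub_self]
      · rw [coeff_sub, coeff_C_mul,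
          coeff_eq_zero_of_degree_lt (hp.trans_le (by exact_mod_cast hm)),
          coeff_eq_zero_of_degree_lt ((hφ.degree_eq N).trans_lt (by exact_mod_cast hm))]
        simp)
    refine ⟨fun j => if j = N then b else a j, ?_⟩
    rw [Finset.sum_range_succ, Finset.sum_congr rfl
      (g := fun j => C (a j) * φ j) (fun j hj => by
        simp only [if_neg (Finset.mem_range.1 hj).ne]), ← ha]
    simp

lemma polyIntegral_mul_eq_zero {p : ℝ[X]} {k : ℕ} (hp : p.degree < k) :
    polyIntegral (p * φ k) = 0 := by
  rcases k with _ | k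
  · have : p = 0 := by
      rw [← degree_eq_bot]
      exact Nat.WithBot.lt_zero_iff.1 (by simpa using hp)
    simp [this]
  obtain ⟨a, ha⟩ := hφ.exists_eq_sum k p (by
    rw [degree_le_iff_coeff_zero]
    intro m hm
    exact coeff_eq_zero_of_degree_lt
      (hp.trans_le (by exact_mod_cast Nat.succ_le_of_lt (by exact_mod_cast hm))))
  rw [ha, Finset.sum_mul, map_sum]
  refine Finset.sum_eq_zero fun j hj => ?_
  rw [mul_assoc, ← smul_eq_C_mul, map_smul, hφ.integral_mul, if_neg (Finset.mem_range.1 hj).ne,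
    smul_zero]

lemma polyIntegral_mul_of_degree_le {p : ℝ[X]} {k : ℕ} (hp : p.degree ≤ k) {c : ℝ}
    (hc : p.coeff k = c * (φ k).coeff k) : polyIntegral (p * φ k) = c := by
  have h := hφ.polyIntegral_mul_eq_zero (p := p - C c * φ k) (k := k) (by
    rw [degree_lt_iff_coeff_zero]
    intro m hm
    rcases hm.eq_or_lt with rfl | hm
    · rw [coeff_sub, coeff_C_mul, hc, sub_self]
    · rw [coeff_sub, coeff_C_mul,
        coeff_eq_zero_of_degree_lt (hp.trans_lt (by exact_mod_cast hm)),
        coeff_eq_zero_of_degree_lt ((hφ.degree_eq k).trans_lt (by exact_mod_cast hm))]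
      simp)
  rw [sub_mul, map_sub, mul_assoc, ← smul_eq_C_mul, map_smul, hφ.integral_mul, if_pos rfl] at h
  simp only [smul_eq_mul, mul_one] at h
  linarith

/-- Legendre's differential equation. The operator is symmetric and does not raise degrees, so
`legendreOp (φ k) + k (k + 1) φ k`, which has degree less than `k`, is orthogonal to itself. -/
lemma legendreOp_eq (k : ℕ) : legendreOp (φ k) = -C (k * (k + 1) : ℝ) * φ k := by
  set r := legendreOp (φ k) + C (k * (k + 1) : ℝ) * φ k with hr
  have hd := (hφ.degree_eq k).le
  have hrd : r.degree < k := by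
    rw [degree_lt_iff_coeff_zero]
    intro m hm
    rw [hr, coeff_add, coeff_C_mul, coeff_legendreOp hd hm]
    rcases hm.eq_or_lt with rfl | hm
    · ring
    · rw [coeff_eq_zero_of_degree_lt (hd.trans_lt (by exact_mod_cast hm))]
      ring
  have hL : (legendreOp r).degree < k := by
    rw [degree_lt_iff_coeff_zero] at hrd ⊢
    rcases k with _ | k
    · have : r = 0 := by ext m; simpa using hrd m (Nat.zero_le _)
      intro m _
      simp [this, legendreOp]
    · intro m hm
      refine coeff_eq_zero_of_degree_lt ((degree_legendreOp_le (k := k) ?_).trans_lt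
        (by exact_mod_cast hm))
      rw [degree_le_iff_coeff_zero]
      intro i hi
      exact hrd i (by exact_mod_cast hi)
  have hzero : polyIntegral (r * r) = 0 := by
    conv_lhs => rw [show r * r = legendreOp (φ k) * r + C (k * (k + 1) : ℝ) * (r * φ k) by
      nth_rewrite 1 [hr]; ring]
    rw [map_add, polyIntegral_legendreOp_mul_comm, mul_comm (φ k),
      hφ.polyIntegral_mul_eq_zero hL, ← smul_eq_C_mul, map_smul, hφ.polyIntegral_mul_eq_zero hrd]
    simp
  have := eq_zero_of_polyIntegral_mul_self hzero
  rw [hr] at this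
  linear_combination this

/-- The derivatives `φ k'` are orthogonal for the weight `3 - x²`. -/
lemma polyIntegral_weight_derivative_mul_derivative (i j : ℕ) :
    polyIntegral ((C 3 - X ^ 2) * derivative (φ i) * derivative (φ j)) =
      if i = j then (i * (i + 1) : ℝ) else 0 := by
  have h := polyIntegral_weight_derivative_mul (derivative (φ i)) (φ j)
  change polyIntegral (legendreOp (φ i) * φ j) = _ at h
  rw [hφ.legendreOp_eq, ← C_neg, mul_assoc, ← smul_eq_C_mul, map_smul, hφ.integral_mul] at h
  rw [← neg_eq_iff_eq_neg.2 h]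
  split_ifs <;> simp

/-- Integrating `(x φ²)'` evaluates the boundary values. -/
lemma eval_sq_add_eval_neg_sq (k : ℕ) :
    √3 * ((φ k).eval √3 ^ 2 + (φ k).eval (-√3) ^ 2) = 2 * k + 1 := by
  have h := polyIntegral_derivative (X * (φ k * φ k))
  have h1 : polyIntegral (X * derivative (φ k) * φ k) = k := by
    refine hφ.polyIntegral_mul_of_degree_le ?_ ?_
    · rw [degree_le_iff_coeff_zero]
      intro m hm
      have hm' : k < m := by exact_mod_cast hm
      obtain ⟨m, rfl⟩ : ∃ i, m = i + 1 := ⟨m - 1, by omega⟩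
      rw [coeff_X_mul, coeff_derivative,
        coeff_eq_zero_of_degree_lt ((hφ.degree_eq k).trans_lt hm), zero_mul]
    · rcases k with _ | k
      · simp
      · rw [coeff_X_mul, coeff_derivative]
        push_cast
        ring
  have h2 : derivative (X * (φ k * φ k)) =
      φ k * φ k + (2 : ℝ) • (X * derivative (φ k) * φ k) := by
    rw [smul_eq_C_mul, derivative_mul, derivative_mul, derivative_X]
    simp only [map_ofNat]
    ring
  rw [h2, map_add, map_smul, hφ.integral_mul, if_pos rfl, h1] at h
  simp only [eval_mul, eval_X, smul_eq_mul] at h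
  linarith

/-- The maximum of `|φ k|` on `I_ξ` is attained at an end point, because
`φ² + (3 - x²) φ'² / (k (k + 1))` has derivative `2 x φ'² / (k (k + 1))`. -/
lemma eval_sq_le (k : ℕ) {z : ℝ} (hz : z ∈ Ixi) :
    (φ k).eval z ^ 2 ≤ (φ k).eval √3 ^ 2 + (φ k).eval (-√3) ^ 2 := by
  rcases Nat.eq_zero_or_pos k with rfl | hk
  · have h0 : φ 0 = C ((φ 0).coeff 0) := eq_C_of_degree_le_zero (by simp [hφ.degree_eq 0])
    rw [h0]
    simp only [eval_C]
    nlinarith [sq_nonneg ((φ 0).coeff 0)]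
  have hkk : (0 : ℝ) < k * (k + 1) := by positivity
  set c : ℝ := (k * (k + 1) : ℝ)⁻¹ with hc
  have hc0 : 0 < c := inv_pos.2 hkk
  set V : ℝ[X] := φ k ^ 2 + C c * ((C 3 - X ^ 2) * derivative (φ k) ^ 2) with hV
  have hV' : derivative V = C (2 * c) * X * derivative (φ k) ^ 2 := by
    have hL := hφ.legendreOp_eq k
    have hcc : C c * C (k * (k + 1) : ℝ) = 1 := by
      rw [← C_mul, hc, inv_mul_cancel₀ hkk.ne', C_1]
    rw [legendreOp] at hL
    simp only [hV, derivative_mul, derivative_pow, derivative_add, derivative_sub, derivative_C,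
      derivative_X, Nat.cast_ofNat, C_mul] at hL ⊢
    norm_num at hL ⊢
    simp only [map_ofNat, map_mul, map_add, map_one, map_natCast] at hL hcc ⊢
    linear_combination (2 * C c * derivative (φ k)) * hL - (2 * derivative (φ k) * φ k) * hcc
  have hVz : (φ k).eval z ^ 2 ≤ V.eval z := by
    have : 0 ≤ 3 - z ^ 2 := by
      have h3 := sq_le_sq' (mem_Ixi.1 hz).1 (mem_Ixi.1 hz).2
      rw [Real.sq_sqrt (by norm_num)] at h3
      linarith
    simp only [hV, eval_add, eval_pow, eval_mul, eval_C, eval_sub, eval_X]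
    have : 0 ≤ c * ((3 - z ^ 2) * eval z (derivative (φ k)) ^ 2) := by positivity
    linarith
  have hVe : ∀ x : ℝ, x ^ 2 = 3 → V.eval x = (φ k).eval x ^ 2 := by
    intro x hx
    simp [hV, hx]
  have hd : ∀ x, deriv (fun y => V.eval y) x = 2 * c * x * (derivative (φ k)).eval x ^ 2 := by
    intro x
    rw [V.deriv, hV']
    simp
  rcases le_total 0 z with h0 | h0
  · have hm : MonotoneOn (fun y => V.eval y) (Icc 0 √3) := by
      refine monotoneOn_of_deriv_nonneg (convex_Icc _ _) V.continuous.continuousOn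
        V.differentiable.differentiableOn fun x hx => ?_
      rw [interior_Icc] at hx
      rw [hd]
      have := hx.1
      positivity
    have h1 := hm ⟨h0, (mem_Ixi.1 hz).2⟩ ⟨sqrt_three_pos.le, le_rfl⟩ (mem_Ixi.1 hz).2
    simp only at h1
    rw [hVe √3 (by simp)] at h1
    nlinarith [sq_nonneg ((φ k).eval (-√3))]
  · have hm : AntitoneOn (fun y => V.eval y) (Icc (-√3) 0) := by
      refine antitoneOn_of_deriv_nonpos (convex_Icc _ _) V.continuous.continuousOn
        V.differentiable.differentiableOn fun x hx => ?_
      rw [interior_Icc] at hx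
      rw [hd]
      have h2 := hx.2
      have : 0 ≤ 2 * c * (derivative (φ k)).eval x ^ 2 := by positivity
      nlinarith
    have h1 := hm ⟨le_rfl, by linarith [sqrt_three_pos]⟩ ⟨(mem_Ixi.1 hz).1, h0⟩ (mem_Ixi.1 hz).1
    simp only at h1
    rw [hVe (-√3) (by simp)] at h1
    nlinarith [sq_nonneg ((φ k).eval √3)]

lemma eval_sq_le_two_mul_add_one (k : ℕ) {z : ℝ} (hz : z ∈ Ixi) :
    (φ k).eval z ^ 2 ≤ 2 * k + 1 := by
  have h1 := hφ.eval_sq_le k hz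
  have h2 := hφ.eval_sq_add_eval_neg_sq k
  have h3 : 1 ≤ √3 := Real.one_le_sqrt.2 (by norm_num)
  nlinarith [sq_nonneg ((φ k).eval √3), sq_nonneg ((φ k).eval (-√3))]

end IsOrthonormalBasis

/-! ### Vector-valued polynomials and least squares approximation -/

lemma continuous_toPoly (Ψ : ℕ → ℝ[X]) (c : Fin (N + 1) → State n) :
    Continuous (toPoly Ψ c) := by
  unfold toPoly
  exact continuous_finsetSum _ fun j _ => (Ψ j).continuous.smul continuous_const

lemma memLp_toPoly (Ψ : ℕ → ℝ[X]) (c : Fin (N + 1) → State n) :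
    MemLp (toPoly Ψ c) 2 (volume.restrict Ixi) :=
  memLp_of_continuousOn (continuous_toPoly Ψ c).continuousOn

lemma toPoly_sub (Ψ : ℕ → ℝ[X]) (c d : Fin (N + 1) → State n) (z : ℝ) :
    toPoly Ψ (fun i => c i - d i) z = toPoly Ψ c z - toPoly Ψ d z := by
  simp [toPoly, smul_sub]

lemma integrable_of_memLp {v : ℝ → State n} (hv : MemLp v 2 (volume.restrict Ixi)) :
    IntegrableOn v Ixi := hv.integrable one_le_two

lemma integrable_eval_smul (p : ℝ[X]) {v : ℝ → State n} (hv : IntegrableOn v Ixi) :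
    IntegrableOn (fun z => p.eval z • v z) Ixi :=
  hv.continuousOn_smul p.continuous.continuousOn isCompact_Ixi

lemma integral_inner_toPoly (Ψ : ℕ → ℝ[X]) (c : Fin (N + 1) → State n) {v : ℝ → State n}
    (hv : IntegrableOn v Ixi) :
    ∫ z in Ixi, inner ℝ (v z) (toPoly Ψ c z) =
      ∑ j : Fin (N + 1), inner ℝ (∫ z in Ixi, (Ψ j).eval z • v z) (c j) := by
  have h : ∀ z, inner ℝ (v z) (toPoly Ψ c z) =
      ∑ j : Fin (N + 1), inner ℝ (c j) ((Ψ j).eval z • v z) := by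
    intro z
    rw [toPoly, inner_sum]
    refine Finset.sum_congr rfl fun j _ => ?_
    rw [inner_smul_right, inner_smul_right, real_inner_comm]
  simp_rw [h]
  have hi : ∀ j ∈ (Finset.univ : Finset (Fin (N + 1))),
      Integrable (fun z => inner ℝ (c j) ((Ψ j).eval z • v z)) (volume.restrict Ixi) :=
    fun j _ => Integrable.const_inner (𝕜 := ℝ) (c j) (integrable_eval_smul (Ψ j) hv)
  rw [integral_finsetSum _ hi]
  refine Finset.sum_congr rfl fun j _ => ?_
  rw [integral_inner (integrable_eval_smul (Ψ j) hv), real_inner_comm]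

lemma integral_eval_mul_inner_toPoly (q : ℝ[X]) (Ψ Ψ' : ℕ → ℝ[X])
    (c d : Fin (N + 1) → State n) :
    ∫ z in Ixi, q.eval z * inner ℝ (toPoly Ψ c z) (toPoly Ψ' d z) =
      ∑ i : Fin (N + 1), ∑ j : Fin (N + 1),
        polyIntegral (q * Ψ i * Ψ' j) * inner ℝ (c i) (d j) := by
  have h : ∀ z, q.eval z * inner ℝ (toPoly Ψ c z) (toPoly Ψ' d z) =
      ∑ i : Fin (N + 1), ∑ j : Fin (N + 1),
        (q * Ψ i * Ψ' j).eval z * inner ℝ (c i) (d j) := by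
    intro z
    simp only [toPoly, sum_inner]
    simp only [inner_sum, Finset.mul_sum, inner_smul_left, inner_smul_right, eval_mul,
      conj_trivial]
    refine Finset.sum_congr rfl fun i _ => Finset.sum_congr rfl fun j _ => ?_
    ring
  simp_rw [h]
  rw [integral_finsetSum _ fun i _ => integrable_finsetSum _ fun j _ =>
    (integrable_eval _).mul_const _]
  refine Finset.sum_congr rfl fun i _ => ?_
  rw [integral_finsetSum _ fun j _ => (integrable_eval _).mul_const _]
  refine Finset.sum_congr rfl fun j _ => ?_
  rw [integral_mul_const, polyIntegral_apply]

lemma exists_derivative_eq {q : ℝ[X]} {k : ℕ} (hq : q.degree ≤ k) :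
    ∃ p : ℝ[X], derivative p = q ∧ p.degree ≤ (k + 1 : ℕ) := by
  refine ⟨∑ i ∈ Finset.range (k + 1), C (q.coeff i / (i + 1)) * X ^ (i + 1), ?_, ?_⟩
  · rw [derivative_sum]
    conv_rhs => rw [q.as_sum_range_C_mul_X_pow' (n := k + 1)
      (Nat.lt_succ_of_le (natDegree_le_of_degree_le hq))]
    refine Finset.sum_congr rfl fun i _ => ?_
    rw [derivative_C_mul_X_pow, Nat.add_sub_cancel]
    have : (i : ℝ) + 1 ≠ 0 := by positivity
    push_cast
    rw [div_mul_cancel₀ _ this]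
  · refine (degree_sum_le _ _).trans (Finset.sup_le fun i hi => ?_)
    refine (degree_C_mul_X_pow_le _ _).trans ?_
    exact_mod_cast Finset.mem_range.1 hi

/-- The Fourier coefficients `⟨v, φ i⟩`, `i ≤ N`, of `v`. For an orthonormal basis they are
the coefficients of the least squares approximation of degree `N`. -/
noncomputable def legendreCoeff (φ : ℕ → ℝ[X]) (N : ℕ) (v : ℝ → State n) (i : Fin (N + 1)) :
    State n :=
  ∫ z in Ixi, (φ i).eval z • v z

namespace IsOrthonormalBasis

variable {φ : ℕ → ℝ[X]} (hφ : IsOrthonormalBasis φ)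
include hφ

lemma integral_inner_toPoly_toPoly (c d : Fin (N + 1) → State n) :
    ∫ z in Ixi, inner ℝ (toPoly φ c z) (toPoly φ d z) = ∑ i, inner ℝ (c i) (d i) := by
  have h := integral_eval_mul_inner_toPoly 1 φ φ c d
  simp only [eval_one, one_mul, hφ.integral_mul] at h
  rw [h]
  refine Finset.sum_congr rfl fun i _ => ?_
  rw [Finset.sum_eq_single i (fun j _ hj => by
    rw [if_neg (fun h => hj (Fin.ext h.symm)), zero_mul]) (by simp)]
  simp

lemma l2Norm_toPoly_sq (c : Fin (N + 1) → State n) :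
    l2Norm (toPoly φ c) ^ 2 = ∑ i, ‖c i‖ ^ 2 := by
  rw [l2Norm_sq]
  simp_rw [← real_inner_self_eq_norm_sq]
  exact hφ.integral_inner_toPoly_toPoly c c

/-- The inverse (Nikolskii) inequality between the supremum and the `L²` norm. -/
lemma norm_toPoly_le (c : Fin (N + 1) → State n) {z : ℝ} (hz : z ∈ Ixi) :
    ‖toPoly φ c z‖ ≤ (N + 1) * l2Norm (toPoly φ c) := by
  have h1 : ‖toPoly φ c z‖ ≤ ∑ j : Fin (N + 1), |(φ j).eval z| * ‖c j‖ := by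
    refine (norm_sum_le _ _).trans (Finset.sum_le_sum fun j _ => ?_)
    rw [norm_smul, Real.norm_eq_abs]
  have h2 : ∑ j : Fin (N + 1), |(φ j).eval z| ^ 2 ≤ ((N : ℝ) + 1) ^ 2 := by
    have h3 : ∀ M : ℕ, ∑ j ∈ Finset.range M, (2 * (j : ℝ) + 1) = (M : ℝ) ^ 2 := by
      intro M
      induction M with
      | zero => simp
      | succ M ih => rw [Finset.sum_range_succ, ih]; push_cast; ring
    calc ∑ j : Fin (N + 1), |(φ j).eval z| ^ 2
        ≤ ∑ j : Fin (N + 1), (2 * ((j : ℕ) : ℝ) + 1) := by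
          refine Finset.sum_le_sum fun j _ => ?_
          rw [sq_abs]
          exact hφ.eval_sq_le_two_mul_add_one j hz
      _ = ((N : ℝ) + 1) ^ 2 := by
          rw [Fin.sum_univ_eq_sum_range (fun j : ℕ => 2 * (j : ℝ) + 1), h3]
          push_cast
          ring
  have h4 := Finset.sum_mul_sq_le_sq_mul_sq Finset.univ
    (fun j : Fin (N + 1) => |(φ j).eval z|) (fun j => ‖c j‖)
  rw [← hφ.l2Norm_toPoly_sq] at h4
  refine h1.trans (abs_le_of_sq_le_sq' ?_ (by have := l2Norm_nonneg (toPoly φ c); positivity)).2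
  rw [mul_pow]
  exact h4.trans (mul_le_mul_of_nonneg_right h2 (sq_nonneg _))

/-- A polynomial with vector coefficients is a combination of the `φ j`. -/
lemma exists_toPoly_eq_sum {ι : Type*} (s : Finset ι) (p : ι → ℝ[X]) (e : ι → State n)
    (hp : ∀ i ∈ s, (p i).degree ≤ N) :
    ∃ c : Fin (N + 1) → State n, ∀ z, toPoly φ c z = ∑ i ∈ s, (p i).eval z • e i := by
  choose! a ha using fun i hi => hφ.exists_eq_sum N (p i) (hp i hi)
  refine ⟨fun j => ∑ i ∈ s, a i j • e i, fun z => ?_⟩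
  simp only [toPoly, Finset.smul_sum]
  rw [Finset.sum_comm]
  refine Finset.sum_congr rfl fun i hi => ?_
  conv_rhs => rw [ha i hi]
  rw [eval_finsetSum, Finset.sum_smul, ← Fin.sum_univ_eq_sum_range
    (fun j => (C (a i j) * φ j).eval z • e i)]
  refine Finset.sum_congr rfl fun j _ => ?_
  rw [smul_smul, eval_mul, eval_C, mul_comm]

lemma exists_toPoly_eq_of_le {M : ℕ} (h : N ≤ M) (c : Fin (N + 1) → State n) :
    ∃ d : Fin (M + 1) → State n, toPoly φ d = toPoly φ c := by
  obtain ⟨d, hd⟩ := hφ.exists_toPoly_eq_sum (N := M) Finset.univ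
    (fun j : Fin (N + 1) => φ j) c (fun j _ => by
      rw [hφ.degree_eq]; exact_mod_cast (Nat.lt_succ_iff.1 j.2).trans h)
  exact ⟨d, funext hd⟩

/-- Every polynomial of degree `N` has a primitive of degree `N + 1`. -/
lemma exists_hasDerivAt_toPoly (c : Fin (N + 1) → State n) :
    ∃ d : Fin (N + 1 + 1) → State n, ∀ z, HasDerivAt (toPoly φ d) (toPoly φ c z) z := by
  choose p hp hp' using fun j : Fin (N + 1) =>
    exists_derivative_eq (k := j) (hφ.degree_eq j).le
  obtain ⟨d, hd⟩ := hφ.exists_toPoly_eq_sum (N := N + 1) Finset.univ p c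
    (fun j _ => (hp' j).trans (by exact_mod_cast Nat.lt_iff_add_one_le.1 j.2))
  refine ⟨d, fun z => ?_⟩
  have h := HasDerivAt.fun_sum (u := Finset.univ)
    fun (j : Fin (N + 1)) _ => ((p j).hasDerivAt z).smul_const (c j)
  simp only [hp] at h
  rw [funext hd]
  exact h

/-- `v - P_N v` is orthogonal to all polynomials of degree at most `N`. -/
lemma integral_inner_sub_toPoly_legendreCoeff {v : ℝ → State n}
    (hv : MemLp v 2 (volume.restrict Ixi)) (d : Fin (N + 1) → State n) :
    ∫ z in Ixi, inner ℝ (v z - toPoly φ (legendreCoeff φ N v) z) (toPoly φ d z) = 0 := by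
  simp only [inner_sub_left]
  rw [integral_sub (integrable_inner hv (memLp_toPoly φ d))
    (integrable_inner (memLp_toPoly φ _) (memLp_toPoly φ d)),
    hφ.integral_inner_toPoly_toPoly, integral_inner_toPoly φ d (integrable_of_memLp hv)]
  exact sub_self _

/-- The least squares approximation is the best `L²` approximation. -/
lemma l2Norm_sub_toPoly_legendreCoeff_le {v : ℝ → State n}
    (hv : MemLp v 2 (volume.restrict Ixi)) (d : Fin (N + 1) → State n) :
    l2Norm (fun z => v z - toPoly φ (legendreCoeff φ N v) z) ≤
      l2Norm (fun z => v z - toPoly φ d z) := by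
  set r : ℝ → State n := fun z => v z - toPoly φ (legendreCoeff φ N v) z with hr
  have hrm : MemLp r 2 (volume.restrict Ixi) := hv.sub (memLp_toPoly φ _)
  have hdm : MemLp (fun z => v z - toPoly φ d z) 2 (volume.restrict Ixi) :=
    hv.sub (memLp_toPoly φ _)
  -- `‖r‖² = ⟨v - p, r⟩` for every polynomial `p` of degree at most `N`
  have h0 : l2Norm r ^ 2 = ∫ z in Ixi, inner ℝ (v z - toPoly φ d z) (r z) := by
    have h1 := hφ.integral_inner_sub_toPoly_legendreCoeff hv (fun i => legendreCoeff φ N v i - d i)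
    have h2 : ∀ z, inner ℝ (v z - toPoly φ d z) (r z) =
        ‖r z‖ ^ 2 + inner ℝ (r z) (toPoly φ (fun i => legendreCoeff φ N v i - d i) z) := by
      intro z
      rw [toPoly_sub, real_inner_comm, ← real_inner_self_eq_norm_sq, ← inner_add_right]
      congr 1
      simp only [hr]
      abel
    simp_rw [h2]
    rw [integral_add (integrable_norm_sq hrm) (integrable_inner hrm (memLp_toPoly φ _)), h1,
      add_zero, l2Norm_sq]
  have h3 := integral_inner_le hdm hrm
  rw [← h0, sq] at h3
  rcases (l2Norm_nonneg r).eq_or_lt with h | h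
  · rw [← h]; exact l2Norm_nonneg _
  · exact le_of_mul_le_mul_right h3 h

lemma exists_toPoly_near_of_continuous {g : ℝ → State n} (hg : Continuous g) {ε : ℝ}
    (hε : 0 < ε) :
    ∃ (M : ℕ) (c : Fin (M + 1) → State n), ∀ z ∈ Ixi, ‖g z - toPoly φ c z‖ ≤ ε := by
  have hn : (0 : ℝ) < n + 1 := by positivity
  choose p hp using fun i : Fin n => exists_polynomial_near_of_continuousOn (-√3) √3
    (fun z => g z i) (by fun_prop) (ε / (n + 1)) (by positivity)
  let e : Fin n → State n := fun i => EuclideanSpace.single i 1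
  set M := Finset.univ.sup fun i => (p i).natDegree
  obtain ⟨c, hc⟩ := hφ.exists_toPoly_eq_sum (N := M) Finset.univ p e (fun i hi =>
    degree_le_natDegree.trans (by
      exact_mod_cast Finset.le_sup (f := fun i => (p i).natDegree) hi))
  refine ⟨M, c, fun z hz => ?_⟩
  have h1 : g z = ∑ i, g z i • e i := by
    ext j
    simp [e, Finset.sum_apply, Pi.single_apply]
  rw [hc, h1, ← Finset.sum_sub_distrib]
  calc ‖∑ i, (g z i • e i - (p i).eval z • e i)‖ ≤ ∑ _i : Fin n, ε / (n + 1) := by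
        refine (norm_sum_le _ _).trans (Finset.sum_le_sum fun i _ => ?_)
        rw [← sub_smul, norm_smul, Real.norm_eq_abs, abs_sub_comm]
        simpa [e] using (hp i z hz).le
    _ = n * (ε / (n + 1)) := by simp
    _ ≤ ε := by
        rw [mul_div_assoc', div_le_iff₀ hn]
        nlinarith

/-- Polynomials are dense in `L²(I_ξ; ℝⁿ)`. -/
lemma exists_toPoly_l2Norm_lt {v : ℝ → State n} (hv : MemLp v 2 (volume.restrict Ixi)) {ε : ℝ}
    (hε : 0 < ε) :
    ∃ (M : ℕ) (c : Fin (M + 1) → State n), l2Norm (fun z => v z - toPoly φ c z) < ε := by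
  obtain ⟨g, hg, -⟩ := hv.exists_boundedContinuous_eLpNorm_sub_le (by simp)
    (ε := ENNReal.ofReal (ε / 2)) (by simpa using hε)
  have hgm : MemLp (fun z => g z) 2 (volume.restrict Ixi) :=
    memLp_of_continuousOn g.continuous.continuousOn
  obtain ⟨M, c, hc⟩ := hφ.exists_toPoly_near_of_continuous g.continuous
    (by positivity : 0 < ε / 8)
  refine ⟨M, c, ?_⟩
  have h1 : l2Norm (fun z => v z - g z) ≤ ε / 2 := by
    have hvg : MemLp (fun z => v z - g z) 2 (volume.restrict Ixi) := hv.sub hgm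
    rw [l2Norm_eq_norm_toLp hvg, Lp.norm_toLp]
    exact ENNReal.toReal_le_of_le_ofReal (by positivity) hg
  have h2 := l2Norm_le_of_forall_norm_le (by positivity) hc
  have h3 := l2Norm_sub_le_add hv hgm (memLp_toPoly φ c)
  linarith

end IsOrthonormalBasis

/-! ### Sobolev functions: decay of the approximation error -/

/-- `w'` is the weak derivative of `w`, tested against the polynomials `(3 - x²) p`, which vanish
at the end points of `I_ξ`. -/
def HasPolyWeakDeriv (w w' : ℝ → State n) : Prop :=
  ∀ p : ℝ[X], ∫ z in Ixi, (derivative ((C 3 - X ^ 2) * p)).eval z • w z =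
    -∫ z in Ixi, ((C 3 - X ^ 2) * p).eval z • w' z

lemma HasPolyWeakDeriv.sub {v v' w w' : ℝ → State n} (h : HasPolyWeakDeriv v v')
    (h' : HasPolyWeakDeriv w w') (hv : IntegrableOn v Ixi) (hv' : IntegrableOn v' Ixi)
    (hw : IntegrableOn w Ixi) (hw' : IntegrableOn w' Ixi) :
    HasPolyWeakDeriv (fun z => v z - w z) (fun z => v' z - w' z) := by
  intro p
  simp only [smul_sub]
  rw [integral_sub (integrable_eval_smul _ hv) (integrable_eval_smul _ hw),
    integral_sub (integrable_eval_smul _ hv') (integrable_eval_smul _ hw'), h p, h' p]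
  abel

lemma hasPolyWeakDeriv_of_hasDerivAt {w w' : ℝ → State n} (h : ∀ z, HasDerivAt w (w' z) z)
    (hw' : Continuous w') : HasPolyWeakDeriv w w' := by
  intro p
  set q := (C 3 - X ^ 2) * p with hq
  have hw : Continuous w := continuous_iff_continuousAt.2 fun z => (h z).continuousAt
  have hi1 : IntegrableOn (fun z => (derivative q).eval z • w z) Ixi :=
    integrable_eval_smul _ (hw.continuousOn.integrableOn_compact isCompact_Ixi)
  have hi2 : IntegrableOn (fun z => q.eval z • w' z) Ixi :=
    integrable_eval_smul _ (hw'.continuousOn.integrableOn_compact isCompact_Ixi)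
  rw [eq_neg_iff_add_eq_zero, ← integral_add hi1 hi2, Ixi, integral_Icc_eq_integral_Ioc,
    ← intervalIntegral.integral_of_le (by linarith [sqrt_three_pos]),
    intervalIntegral.integral_eq_sub_of_hasDerivAt (f := fun z => q.eval z • w z)]
  · simp [hq]
  · intro x _
    rw [add_comm]
    exact (q.hasDerivAt x).smul (h x)
  · exact (((derivative q).continuous.smul hw).add
      (q.continuous.smul hw')).intervalIntegrable _ _

namespace IsOrthonormalBasis

variable {φ : ℕ → ℝ[X]} (hφ : IsOrthonormalBasis φ)
include hφ

/-- The Fourier modes of degree greater than `N` of a function with weak derivative `w'`: the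
coefficients of `w` are, up to the factors `k (k + 1)`, those of `w'` with respect to
the orthogonal functions `(3 - x²) φ k'`. -/
lemma l2Norm_high_modes_le {w w' : ℝ → State n} (hw' : MemLp w' 2 (volume.restrict Ixi))
    (h : HasPolyWeakDeriv w w') (M : ℕ) :
    l2Norm (toPoly φ (fun i : Fin (M + 1) => if (i : ℕ) ≤ N then 0 else legendreCoeff φ M w i)) ≤
      √3 / (N + 1) * l2Norm w' := by
  set x : Fin (M + 1) → State n := fun i => if (i : ℕ) ≤ N then 0 else legendreCoeff φ M w i with hx
  set k : ℕ → ℝ := fun i => (i : ℝ) * (i + 1) with hk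
  set r : Fin (M + 1) → State n := fun i => (k i)⁻¹ • x i with hr
  set Ψ : ℕ → ℝ[X] := fun i => (C 3 - X ^ 2) * derivative (φ i) with hΨ
  have hxi : ∀ i, x i = 0 ∨ (((N : ℝ) + 1) ^ 2 ≤ k i ∧ x i = legendreCoeff φ M w i) := by
    intro i
    by_cases hi : (i : ℕ) ≤ N
    · left; simp [hx, hi]
    · right
      refine ⟨?_, by simp [hx, hi]⟩
      have : (N : ℝ) + 1 ≤ (i : ℕ) := by exact_mod_cast not_le.1 hi
      simp only [hk]
      nlinarith [(Nat.cast_nonneg N : (0 : ℝ) ≤ N)]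
  have hN : (0 : ℝ) < N + 1 := by positivity
  have hS : l2Norm (toPoly φ x) ^ 2 = ∫ z in Ixi, inner ℝ (w' z) (toPoly Ψ r z) := by
    rw [hφ.l2Norm_toPoly_sq, integral_inner_toPoly _ _ (integrable_of_memLp hw')]
    refine Finset.sum_congr rfl fun i _ => ?_
    rcases hxi i with h0 | ⟨hki, hc⟩
    · simp [hr, h0]
    · have hki0 : k i ≠ 0 := (lt_of_lt_of_le (by positivity) hki).ne'
      have h1 := h (derivative (φ i))
      have h2 : derivative ((C 3 - X ^ 2) * derivative (φ i)) = -C (k i) * φ i :=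
        hφ.legendreOp_eq i
      have h3 : k i • legendreCoeff φ M w i = ∫ z in Ixi, (Ψ i).eval z • w' z := by
        rw [h2] at h1
        simp only [eval_mul, eval_neg, eval_C, neg_mul, neg_smul, mul_smul, integral_neg,
          integral_smul] at h1
        rw [legendreCoeff, neg_injective h1]
        simp only [hΨ, eval_mul, mul_smul]
      rw [← h3, ← hc]
      simp only [hr]
      rw [inner_smul_left, inner_smul_right, real_inner_self_eq_norm_sq, conj_trivial,
        ← mul_assoc, mul_inv_cancel₀ hki0, one_mul]
  have hR : l2Norm (toPoly Ψ r) ^ 2 ≤ (√3 / (N + 1) * l2Norm (toPoly φ x)) ^ 2 := by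
    have hΨz : ∀ z, toPoly Ψ r z = (3 - z ^ 2) • toPoly (fun i => derivative (φ i)) r z := by
      intro z
      simp [toPoly, hΨ, Finset.smul_sum, mul_smul]
    have hcont := continuous_toPoly (fun i => derivative (φ i)) r
    calc l2Norm (toPoly Ψ r) ^ 2
        ≤ ∫ z in Ixi, 3 * ((C 3 - X ^ 2 : ℝ[X]).eval z *
          inner ℝ (toPoly (fun i => derivative (φ i)) r z)
            (toPoly (fun i => derivative (φ i)) r z)) := by
          rw [l2Norm_sq]
          refine integral_mono_of_nonneg (ae_of_all _ fun _ => by positivity) ?_ ?_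
          · have hc' : Continuous fun z => 3 * ((C 3 - X ^ 2 : ℝ[X]).eval z *
                inner ℝ (toPoly (fun i => derivative (φ i)) r z)
                  (toPoly (fun i => derivative (φ i)) r z)) :=
              continuous_const.mul ((Polynomial.continuous _).mul (hcont.inner hcont))
            exact hc'.continuousOn.integrableOn_compact isCompact_Ixi
          · filter_upwards [ae_restrict_mem measurableSet_Ixi] with z hz
            have h3 := sq_le_sq' (mem_Ixi.1 hz).1 (mem_Ixi.1 hz).2
            rw [Real.sq_sqrt (by norm_num)] at h3
            rw [hΨz, norm_smul, mul_pow, real_inner_self_eq_norm_sq, Real.norm_eq_abs, sq_abs]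
            simp only [eval_sub, eval_C, eval_pow, eval_X]
            rw [← mul_assoc]
            refine mul_le_mul_of_nonneg_right ?_ (sq_nonneg _)
            nlinarith [sq_nonneg z]
      _ = 3 * ∑ i : Fin (M + 1), k i * ‖r i‖ ^ 2 := by
          rw [integral_const_mul, integral_eval_mul_inner_toPoly]
          congr 1
          refine Finset.sum_congr rfl fun i _ => ?_
          rw [Finset.sum_eq_single i (fun j _ hj => by
            rw [hφ.polyIntegral_weight_derivative_mul_derivative,
              if_neg (fun h => hj (Fin.ext h.symm)), zero_mul]) (by simp),
            hφ.polyIntegral_weight_derivative_mul_derivative, if_pos rfl,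
            real_inner_self_eq_norm_sq]
      _ ≤ 3 * ∑ i : Fin (M + 1), (((N : ℝ) + 1) ^ 2)⁻¹ * ‖x i‖ ^ 2 := by
          refine mul_le_mul_of_nonneg_left (Finset.sum_le_sum fun i _ => ?_) (by norm_num)
          rcases hxi i with h0 | ⟨hki, -⟩
          · simp [hr, h0]
          · have hki0 : 0 < k i := lt_of_lt_of_le (by positivity) hki
            simp only [hr]
            rw [norm_smul, mul_pow, Real.norm_eq_abs, sq_abs, ← mul_assoc]
            refine mul_le_mul_of_nonneg_right ?_ (sq_nonneg _)
            rw [sq, ← mul_assoc, mul_inv_cancel₀ hki0.ne', one_mul]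
            exact inv_anti₀ (by positivity) hki
      _ = (√3 / (N + 1) * l2Norm (toPoly φ x)) ^ 2 := by
          rw [mul_pow, hφ.l2Norm_toPoly_sq, div_pow, Real.sq_sqrt (by norm_num),
            ← Finset.mul_sum]
          ring
  have hR' := abs_le_of_sq_le_sq' hR (mul_nonneg (by positivity) (l2Norm_nonneg _))
  have h4 := integral_inner_le hw' (memLp_toPoly Ψ r)
  rw [← hS] at h4
  have h5 := h4.trans (mul_le_mul_of_nonneg_left hR'.2 (l2Norm_nonneg w'))
  rcases (l2Norm_nonneg (toPoly φ x)).eq_or_lt with h0 | h0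
  · rw [← h0]
    exact mul_nonneg (by positivity) (l2Norm_nonneg _)
  · refine le_of_mul_le_mul_right ?_ h0
    rw [← sq]
    refine h5.trans_eq ?_
    ring

/-- The error of best approximation of a function with weak derivative in `L²`. -/
lemma l2Norm_sub_le_of_hasPolyWeakDeriv {w w' : ℝ → State n}
    (hw : MemLp w 2 (volume.restrict Ixi)) (hw' : MemLp w' 2 (volume.restrict Ixi))
    (h : HasPolyWeakDeriv w w') (N : ℕ) :
    l2Norm (fun z => w z - toPoly φ (legendreCoeff φ N w) z) ≤ √3 / (N + 1) * l2Norm w' := by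
  refine le_of_forall_pos_le_add fun ε hε => ?_
  obtain ⟨M, c, hc⟩ := hφ.exists_toPoly_l2Norm_lt hw hε
  set x : Fin (M + 1) → State n := fun i => if (i : ℕ) ≤ N then 0 else legendreCoeff φ M w i with hx
  have hlow := hφ.exists_toPoly_eq_sum (N := N) {i : Fin (M + 1) | (i : ℕ) ≤ N}
    (fun i => φ i) (legendreCoeff φ M w) (fun i hi => by
      rw [hφ.degree_eq]; exact_mod_cast (Finset.mem_filter.1 hi).2)
  obtain ⟨d, hd⟩ := hlow
  have hdx : ∀ z, toPoly φ d z = toPoly φ (legendreCoeff φ M w) z - toPoly φ x z := by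
    intro z
    rw [hd, ← toPoly_sub, toPoly, Finset.sum_filter]
    refine Finset.sum_congr rfl fun i _ => ?_
    by_cases hi : (i : ℕ) ≤ N <;> simp [hx, hi]
  have hm : MemLp (fun z => w z - toPoly φ (legendreCoeff φ M w) z) 2 (volume.restrict Ixi) :=
    hw.sub (memLp_toPoly φ _)
  calc l2Norm (fun z => w z - toPoly φ (legendreCoeff φ N w) z)
      ≤ l2Norm (fun z => w z - toPoly φ d z) := hφ.l2Norm_sub_toPoly_legendreCoeff_le hw d
    _ = l2Norm (fun z => (w z - toPoly φ (legendreCoeff φ M w) z) + toPoly φ x z) := by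
        congr 1
        funext z
        rw [hdx]
        abel
    _ ≤ l2Norm (fun z => w z - toPoly φ (legendreCoeff φ M w) z) + l2Norm (toPoly φ x) :=
        l2Norm_add_le hm (memLp_toPoly φ x)
    _ ≤ ε + √3 / (N + 1) * l2Norm w' :=
        add_le_add ((hφ.l2Norm_sub_toPoly_legendreCoeff_le hw c).trans hc.le)
          (hφ.l2Norm_high_modes_le hw' h M)
    _ = _ := add_comm _ _

/-- One derivative gains one order: a primitive of a polynomial approximation of `w'` can be
subtracted from `w`. -/
lemma l2Norm_sub_succ_le {w w' : ℝ → State n}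
    (hw : MemLp w 2 (volume.restrict Ixi)) (hw' : MemLp w' 2 (volume.restrict Ixi))
    (h : HasPolyWeakDeriv w w') (c : Fin (N + 1) → State n) :
    l2Norm (fun z => w z - toPoly φ (legendreCoeff φ (N + 1) w) z) ≤
      √3 / (N + 1) * l2Norm (fun z => w' z - toPoly φ c z) := by
  obtain ⟨d, hd⟩ := hφ.exists_hasDerivAt_toPoly c
  have hdm := memLp_toPoly φ d
  have hcm := memLp_toPoly φ c
  have hwd : MemLp (fun z => w z - toPoly φ d z) 2 (volume.restrict Ixi) := hw.sub hdm
  have hwc : MemLp (fun z => w' z - toPoly φ c z) 2 (volume.restrict Ixi) := hw'.sub hcm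
  have h1 := hφ.l2Norm_sub_le_of_hasPolyWeakDeriv hwd hwc
    (h.sub (hasPolyWeakDeriv_of_hasDerivAt hd (continuous_toPoly φ c))
      (integrable_of_memLp hw) (integrable_of_memLp hw') (integrable_of_memLp hdm)
      (integrable_of_memLp hcm)) (N + 1)
  set e := legendreCoeff φ (N + 1) fun z => w z - toPoly φ d z
  have h2 := hφ.l2Norm_sub_toPoly_legendreCoeff_le hw (fun i => d i - -e i)
  have h3 : ∀ z, w z - toPoly φ (fun i => d i - -e i) z = w z - toPoly φ d z - toPoly φ e z := by
    intro z
    have : toPoly φ (fun i => -e i) z = -toPoly φ e z := by simp [toPoly]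
    rw [toPoly_sub, this]
    abel
  simp_rw [h3] at h2
  refine h2.trans (h1.trans (mul_le_mul_of_nonneg_right ?_ (l2Norm_nonneg _)))
  refine div_le_div_of_nonneg_left (Real.sqrt_nonneg _) (by positivity) ?_
  push_cast
  linarith

end IsOrthonormalBasis

/-! ### Weak derivatives tested against polynomials -/

lemma hasWeakDeriv_zero_self (u : ℝ → State n) : HasWeakDeriv 0 u u := by
  intro φ _ _ _
  simp

/-- Weak derivatives of consecutive orders of `u` are related by one weak derivative: test with
`φ'` in place of `φ`. -/
lemma HasWeakDeriv.one_of_succ {k : ℕ} {u g g' : ℝ → State n} (h : HasWeakDeriv k u g)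
    (h' : HasWeakDeriv (k + 1) u g') : HasWeakDeriv 1 g g' := by
  intro φ hφ hc hs
  have hd : ContDiff ℝ (⊤ : ℕ∞) (deriv φ) := by
    have := (contDiff_infty_iff_deriv (𝕜 := ℝ)).1 hφ
    exact this.2
  have h1 := h (deriv φ) hd hc.deriv
    ((closure_minimal support_deriv_subset (isClosed_tsupport _)).trans hs)
  have h2 := h' φ hφ hc hs
  rw [iteratedDeriv_succ', h1, pow_succ, mul_smul] at h2
  rw [iteratedDeriv_one]
  have h3 : ((-1 : ℝ) ^ k) ≠ 0 := pow_ne_zero _ (by norm_num)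
  simpa using smul_right_injective _ h3 h2

lemma deriv_smoothTransition_of_neg {y : ℝ} (hy : y < 0) :
    deriv Real.smoothTransition y = 0 := by
  have : Real.smoothTransition =ᶠ[nhds y] fun _ => 0 := by
    filter_upwards [Iio_mem_nhds hy] with x hx
    exact Real.smoothTransition.zero_of_nonpos hx.le
  rw [this.deriv_eq, deriv_const]

lemma deriv_smoothTransition_of_one_lt {y : ℝ} (hy : 1 < y) :
    deriv Real.smoothTransition y = 0 := by
  have : Real.smoothTransition =ᶠ[nhds y] fun _ => 1 := by
    filter_upwards [Ioi_mem_nhds hy] with x hx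
    exact Real.smoothTransition.one_of_one_le hx.le
  rw [this.deriv_eq, deriv_const]

lemma exists_bound_mul_deriv_smoothTransition :
    ∃ B : ℝ, ∀ y, |y * deriv Real.smoothTransition (y - 1)| ≤ B := by
  have hc : Continuous fun y => y * deriv Real.smoothTransition (y - 1) :=
    continuous_id.mul ((Real.smoothTransition.contDiff (n := 1)).continuous_deriv_one.comp
      (continuous_id.sub continuous_const))
  obtain ⟨B, hB⟩ := (isCompact_Icc (a := (1 : ℝ)) (b := 2)).exists_bound_of_continuousOn
    hc.continuousOn
  refine ⟨max B 0, fun y => ?_⟩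
  rcases lt_or_ge y 1 with h | h
  · rw [deriv_smoothTransition_of_neg (by linarith)]; simp
  rcases lt_or_ge 2 y with h' | h'
  · rw [deriv_smoothTransition_of_one_lt (by linarith)]; simp
  · exact (hB y ⟨h, h'⟩).trans (le_max_left _ _)

/-- A smooth cut-off function: it vanishes where `3 - z² ≤ 1 / k` and is `1` where
`3 - z² ≥ 2 / k`. -/
noncomputable def cutoff (k : ℕ) (z : ℝ) : ℝ := Real.smoothTransition (k * (3 - z ^ 2) - 1)

lemma contDiff_cutoff (k : ℕ) : ContDiff ℝ (⊤ : ℕ∞) (cutoff k) :=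
  Real.smoothTransition.contDiff.comp
    ((contDiff_const.mul (contDiff_const.sub (contDiff_id.pow 2))).sub contDiff_const)

lemma abs_cutoff_le_one (k : ℕ) (z : ℝ) : |cutoff k z| ≤ 1 := by
  rw [cutoff, abs_of_nonneg (Real.smoothTransition.nonneg _)]
  exact Real.smoothTransition.le_one _

lemma eventually_two_lt_mul {z : ℝ} (hz : 0 < 3 - z ^ 2) :
    ∀ᶠ k : ℕ in atTop, 2 < (k : ℝ) * (3 - z ^ 2) :=
  (tendsto_natCast_atTop_atTop.atTop_mul_const hz).eventually_gt_atTop 2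

lemma tsupport_cutoff_subset (k : ℕ) : tsupport (cutoff k) ⊆ interior Ixi := by
  have h1 : tsupport (cutoff k) ⊆ {z | 1 ≤ k * (3 - z ^ 2)} := by
    refine closure_minimal (fun z hz => ?_)
      (isClosed_le continuous_const (by fun_prop))
    by_contra hlt
    exact hz (Real.smoothTransition.zero_of_nonpos (by
      have := not_le.1 (show ¬ 1 ≤ (k : ℝ) * (3 - z ^ 2) from hlt)
      linarith))
  refine h1.trans fun z hz => ?_
  have hz' : 1 ≤ (k : ℝ) * (3 - z ^ 2) := hz
  have h3 : 0 < 3 - z ^ 2 := by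
    by_contra hle
    have := mul_nonpos_of_nonneg_of_nonpos (Nat.cast_nonneg (α := ℝ) k) (not_lt.1 hle)
    linarith
  rw [Ixi, interior_Icc]
  exact abs_lt.1 (Real.lt_sqrt (abs_nonneg z) |>.2 (by rw [sq_abs]; linarith))

lemma deriv_eval_mul_cutoff (p : ℝ[X]) (k : ℕ) (z : ℝ) :
    deriv (fun y => ((C 3 - X ^ 2) * p).eval y * cutoff k y) z =
      (derivative ((C 3 - X ^ 2) * p)).eval z * cutoff k z -
        2 * z * p.eval z * ((k * (3 - z ^ 2)) *
          deriv Real.smoothTransition (k * (3 - z ^ 2) - 1)) := by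
  have h1 : HasDerivAt (fun y : ℝ => (k : ℝ) * (3 - y ^ 2) - 1) (k * (-(2 * z))) z := by
    have := (((hasDerivAt_pow 2 z).const_sub 3).const_mul (k : ℝ)).sub_const 1
    simpa using this
  have h2 : HasDerivAt Real.smoothTransition
      (deriv Real.smoothTransition (k * (3 - z ^ 2) - 1)) (k * (3 - z ^ 2) - 1) :=
    ((Real.smoothTransition.contDiff (n := 1)).differentiable (by norm_num) _).hasDerivAt
  have h3 : HasDerivAt (cutoff k) _ z := h2.comp z h1
  have h4 := (((C 3 - X ^ 2) * p).hasDerivAt z).mul h3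
  refine h4.deriv.trans ?_
  simp only [eval_mul, eval_sub, eval_C, eval_pow, eval_X]
  ring

/-- Weak derivatives may be tested against polynomials vanishing at the end points: multiply
by cut-off functions and pass to the limit. -/
lemma HasWeakDeriv.hasPolyWeakDeriv {v v' : ℝ → State n} (h : HasWeakDeriv 1 v v')
    (hv : IntegrableOn v Ixi) (hv' : IntegrableOn v' Ixi) : HasPolyWeakDeriv v v' := by
  intro p
  set q := (C 3 - X ^ 2) * p with hq
  obtain ⟨B, hB⟩ := exists_bound_mul_deriv_smoothTransition
  have hint : ∀ᵐ z ∂(volume.restrict Ixi), 0 < 3 - z ^ 2 := by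
    have h1 : volume.restrict Ixi = volume.restrict (Ioo (-√3) √3) :=
      (Measure.restrict_congr_set Ioo_ae_eq_Icc).symm
    rw [h1]
    filter_upwards [ae_restrict_mem measurableSet_Ioo] with z hz
    have h3 := sq_lt_sq' hz.1 hz.2
    rw [Real.sq_sqrt (by norm_num)] at h3
    linarith
  have hweak : ∀ k : ℕ, ∫ z in Ixi, ((derivative q).eval z * cutoff k z -
        2 * z * p.eval z * ((k * (3 - z ^ 2)) *
          deriv Real.smoothTransition (k * (3 - z ^ 2) - 1))) • v z =
      -∫ z in Ixi, (q.eval z * cutoff k z) • v' z := by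
    intro k
    have hsupp : tsupport (fun y => q.eval y * cutoff k y) ⊆ tsupport (cutoff k) :=
      tsupport_mul_subset_right
    have h1 := h (fun y => q.eval y * cutoff k y)
      ((by simpa using q.contDiff_aeval (𝕜 := ℝ) (⊤ : ℕ∞) :
        ContDiff ℝ (⊤ : ℕ∞) fun y => q.eval y).mul (contDiff_cutoff k))
      (isCompact_Ixi.of_isClosed_subset (isClosed_tsupport _)
        (hsupp.trans ((tsupport_cutoff_subset k).trans interior_subset)))
      (hsupp.trans (tsupport_cutoff_subset k))
    simp only [iteratedDeriv_one, pow_one, neg_smul, one_smul] at h1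
    rw [← h1]
    refine integral_congr_ae (ae_of_all _ fun z => ?_)
    simp only
    rw [hq, deriv_eval_mul_cutoff]
  have hT : Continuous (deriv Real.smoothTransition) :=
    (Real.smoothTransition.contDiff (n := 1)).continuous_deriv_one
  have hlim1 : Tendsto (fun k : ℕ => ∫ z in Ixi, ((derivative q).eval z * cutoff k z -
        2 * z * p.eval z * ((k * (3 - z ^ 2)) *
          deriv Real.smoothTransition (k * (3 - z ^ 2) - 1))) • v z) atTop
      (nhds (∫ z in Ixi, (derivative q).eval z • v z)) := by
    refine tendsto_integral_of_dominated_convergence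
      (fun z => ‖(|(derivative q).eval z| + |2 * z * p.eval z| * B) • v z‖) (fun k => ?_) ?_
      (fun k => ?_) ?_
    · refine AEStronglyMeasurable.fun_smul (Continuous.aestronglyMeasurable ?_) hv.1
      exact ((Polynomial.continuous _).mul (contDiff_cutoff k).continuous).sub
        (((continuous_const.mul continuous_id).mul (Polynomial.continuous _)).mul
          ((by fun_prop : Continuous fun z : ℝ => (k : ℝ) * (3 - z ^ 2)).mul
            (hT.comp (by fun_prop))))
    · refine (Integrable.norm ?_)
      refine IntegrableOn.continuousOn_smul hv (Continuous.continuousOn ?_) isCompact_Ixi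
      exact (Polynomial.continuous _).abs.add
        (((continuous_const.mul continuous_id).mul (Polynomial.continuous _)).abs.mul
          continuous_const)
    · refine ae_of_all _ fun z => ?_
      have hB0 : 0 ≤ B := (abs_nonneg _).trans (hB 0)
      rw [norm_smul, norm_smul]
      refine mul_le_mul_of_nonneg_right ?_ (norm_nonneg _)
      rw [Real.norm_eq_abs, Real.norm_eq_abs, abs_of_nonneg (a := _ + _) (by positivity)]
      refine (abs_sub _ _).trans (add_le_add ?_ ?_)
      · rw [abs_mul]
        exact mul_le_of_le_one_right (abs_nonneg _) (abs_cutoff_le_one k z)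
      · rw [abs_mul]
        exact mul_le_mul_of_nonneg_left (hB _) (abs_nonneg _)
    · filter_upwards [hint] with z hz
      refine tendsto_const_nhds.congr' ?_
      filter_upwards [eventually_two_lt_mul hz] with k hk
      rw [deriv_smoothTransition_of_one_lt (by linarith), cutoff,
        Real.smoothTransition.one_of_one_le (by linarith)]
      simp
  have hlim2 : Tendsto (fun k : ℕ => -∫ z in Ixi, (q.eval z * cutoff k z) • v' z) atTop
      (nhds (-∫ z in Ixi, q.eval z • v' z)) := by
    refine (tendsto_integral_of_dominated_convergence
      (fun z => ‖q.eval z • v' z‖) (fun k => ?_) ?_ (fun k => ?_) ?_).neg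
    · exact AEStronglyMeasurable.fun_smul
        (q.continuous.mul (contDiff_cutoff k).continuous).aestronglyMeasurable hv'.1
    · exact (integrable_eval_smul q hv').norm
    · refine ae_of_all _ fun z => ?_
      rw [norm_smul, norm_smul, norm_mul]
      refine mul_le_mul_of_nonneg_right ?_ (norm_nonneg _)
      exact mul_le_of_le_one_right (norm_nonneg _) (abs_cutoff_le_one k z)
    · filter_upwards [hint] with z hz
      refine tendsto_const_nhds.congr' ?_
      filter_upwards [eventually_two_lt_mul hz] with k hk
      rw [cutoff, Real.smoothTransition.one_of_one_le (by linarith), mul_one]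
  simp_rw [hweak] at hlim1
  exact tendsto_nhds_unique hlim1 hlim2

/-! ### Fractional smoothness: moving averages -/

lemma lintegral_sq_le {α : Type*} [MeasurableSpace α] (ν : Measure α) {f : α → ENNReal}
    (hf : AEMeasurable f ν) : (∫⁻ x, f x ∂ν) ^ 2 ≤ ν univ * ∫⁻ x, f x ^ 2 ∂ν := by
  have h := ENNReal.lintegral_mul_le_Lp_mul_Lq ν Real.HolderConjugate.two_two hf
    (aemeasurable_const (b := (1 : ENNReal)))
  simp only [Pi.mul_apply, mul_one, ENNReal.one_rpow, lintegral_one] at h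
  have h2 := pow_le_pow_left₀ (zero_le) h 2
  rw [mul_pow] at h2
  have h3 : ∀ a : ENNReal, (a ^ (1 / 2 : ℝ)) ^ 2 = a := by
    intro a
    rw [← ENNReal.rpow_natCast, ← ENNReal.rpow_mul]
    norm_num
  rw [h3, h3, mul_comm] at h2
  simpa using h2

lemma l2Norm_le_of_lintegral_le {v : ℝ → State n} {C : ℝ} (hC : 0 ≤ C)
    (hv : MemLp v 2 (volume.restrict Ixi))
    (h : ∫⁻ z in Ixi, ‖v z‖ₑ ^ 2 ≤ ENNReal.ofReal (C ^ 2)) : l2Norm v ≤ C := by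
  refine Real.sqrt_le_iff.2 ⟨hC, ?_⟩
  rw [integral_eq_lintegral_of_nonneg_ae (ae_of_all _ fun _ => by positivity)
    (integrable_norm_sq hv).1]
  refine ENNReal.toReal_le_of_le_ofReal (sq_nonneg C) ?_
  simpa [ENNReal.ofReal_pow] using h

lemma enorm_sq_eq_ofReal (x : State n) : ‖x‖ₑ ^ 2 = ENNReal.ofReal (‖x‖ ^ 2) := by
  rw [ENNReal.ofReal_pow (norm_nonneg _), ofReal_norm]

lemma enorm_sub_sq_le (x y z : State n) :
    ‖x - y‖ₑ ^ 2 ≤ 2 * (‖x - z‖ₑ ^ 2 + ‖y - z‖ₑ ^ 2) := by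
  have key : ‖x - y‖ ^ 2 ≤ 2 * (‖x - z‖ ^ 2 + ‖y - z‖ ^ 2) := by
    have h := norm_sub_le (x - z) (y - z)
    rw [sub_sub_sub_cancel_right] at h
    nlinarith [norm_nonneg (x - y), sq_nonneg (‖x - z‖ - ‖y - z‖)]
  have h := ENNReal.ofReal_le_ofReal key
  rw [ENNReal.ofReal_mul (by norm_num), ENNReal.ofReal_add (by positivity) (by positivity)] at h
  simpa only [enorm_sq_eq_ofReal, ENNReal.ofReal_ofNat] using h

/-- The inner integral of the Gagliardo seminorm. -/
noncomputable def gagliardoDensity (θ : ℝ) (g : ℝ → State n) (x : ℝ) : ENNReal :=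
  ∫⁻ y in Ixi, ENNReal.ofReal (‖g x - g y‖ ^ 2 / |x - y| ^ (1 + 2 * θ))

lemma measurable_gagliardoDensity {θ : ℝ} {g : ℝ → State n} (hg : Measurable g) :
    Measurable (gagliardoDensity θ g) := by
  unfold gagliardoDensity
  refine Measurable.lintegral_prod_right' (f := fun p : ℝ × ℝ =>
    ENNReal.ofReal (‖g p.1 - g p.2‖ ^ 2 / |p.1 - p.2| ^ (1 + 2 * θ))) ?_
  fun_prop

lemma gagliardo_congr_ae {θ : ℝ} {g g' : ℝ → State n} (h : g =ᵐ[volume.restrict Ixi] g') :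
    gagliardo θ g = gagliardo θ g' := by
  unfold gagliardo
  refine lintegral_congr_ae ?_
  filter_upwards [h] with x hx
  refine lintegral_congr_ae ?_
  filter_upwards [h] with y hy
  rw [hx, hy]

/-- The deviation of `g` from its mean over a window of length `h` near `x`. -/
lemma enorm_sub_average_sq_le {θ : ℝ} (hθ : 0 ≤ θ) {g : ℝ → State n} (hg : Measurable g)
    (hgi : Integrable g) {h y x : ℝ} (hh : 0 < h) (hS : Ioc y (y + h) ⊆ Ixi) (hyx : y ≤ x)
    (hxy : x ≤ y + h) :
    ‖g x - h⁻¹ • ∫ t in Ioc y (y + h), g t‖ₑ ^ 2 ≤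
      ENNReal.ofReal (h ^ (2 * θ)) * gagliardoDensity θ g x := by
  have hvol : volume (Ioc y (y + h)) = ENNReal.ofReal h := by rw [Real.volume_Ioc]; congr 1; ring
  have h1 : g x - h⁻¹ • ∫ t in Ioc y (y + h), g t =
      h⁻¹ • ∫ t in Ioc y (y + h), (g x - g t) := by
    rw [integral_sub (integrable_const _) hgi.integrableOn, smul_sub, setIntegral_const,
      Measure.real, hvol, ENNReal.toReal_ofReal hh.le, smul_smul, inv_mul_cancel₀ hh.ne', one_smul]
  have h2 : (∫⁻ t in Ioc y (y + h), ‖g x - g t‖ₑ) ^ 2 ≤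
      ENNReal.ofReal h * ∫⁻ t in Ioc y (y + h), ‖g x - g t‖ₑ ^ 2 := by
    have := lintegral_sq_le (volume.restrict (Ioc y (y + h))) (f := fun t => ‖g x - g t‖ₑ)
      (by fun_prop)
    rwa [Measure.restrict_apply_univ, hvol] at this
  have h3 : ∫⁻ t in Ioc y (y + h), ‖g x - g t‖ₑ ^ 2 ≤
      ENNReal.ofReal (h ^ (1 + 2 * θ)) * gagliardoDensity θ g x := by
    calc ∫⁻ t in Ioc y (y + h), ‖g x - g t‖ₑ ^ 2
        ≤ ∫⁻ t in Ioc y (y + h), ENNReal.ofReal (h ^ (1 + 2 * θ)) *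
            ENNReal.ofReal (‖g x - g t‖ ^ 2 / |x - t| ^ (1 + 2 * θ)) := by
          refine setLIntegral_mono' measurableSet_Ioc fun t ht => ?_
          rw [enorm_sq_eq_ofReal, ← ENNReal.ofReal_mul (by positivity)]
          refine ENNReal.ofReal_le_ofReal ?_
          rcases eq_or_ne x t with rfl | hne
          · simp
          have hpos : 0 < |x - t| := abs_pos.2 (sub_ne_zero.2 hne)
          have hle : |x - t| ≤ h := abs_le.2 ⟨by linarith [ht.2], by linarith [ht.1]⟩
          rw [mul_div_assoc', le_div_iff₀ (by positivity), mul_comm]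
          exact mul_le_mul_of_nonneg_right
            (Real.rpow_le_rpow hpos.le hle (by positivity)) (sq_nonneg _)
      _ = ENNReal.ofReal (h ^ (1 + 2 * θ)) * ∫⁻ t in Ioc y (y + h),
            ENNReal.ofReal (‖g x - g t‖ ^ 2 / |x - t| ^ (1 + 2 * θ)) :=
          lintegral_const_mul _ (by fun_prop)
      _ ≤ _ := by
          refine mul_le_mul_right (lintegral_mono_set hS) _
  rw [h1, enorm_smul, mul_pow]
  calc ‖h⁻¹‖ₑ ^ 2 * ‖∫ t in Ioc y (y + h), (g x - g t)‖ₑ ^ 2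
      ≤ ‖h⁻¹‖ₑ ^ 2 * (ENNReal.ofReal h *
          (ENNReal.ofReal (h ^ (1 + 2 * θ)) * gagliardoDensity θ g x)) := by
        refine mul_le_mul_right ?_ _
        refine (pow_le_pow_left₀ zero_le (enorm_integral_le_lintegral_enorm _) 2).trans ?_
        exact h2.trans (mul_le_mul_right h3 _)
    _ = ENNReal.ofReal (h ^ (2 * θ)) * gagliardoDensity θ g x := by
        have hi : ‖h⁻¹‖ₑ = ENNReal.ofReal h⁻¹ := Real.enorm_of_nonneg (by positivity)
        rw [hi, ← ENNReal.ofReal_pow (by positivity), ← mul_assoc, ← mul_assoc,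
          ← ENNReal.ofReal_mul (by positivity), ← ENNReal.ofReal_mul (by positivity)]
        congr 2
        rw [Real.rpow_add hh, Real.rpow_one]
        field_simp

/-- Indefinite integrals are weakly differentiable. -/
lemma hasPolyWeakDeriv_integral_Iic {f : ℝ → State n} (hf : Integrable f) :
    HasPolyWeakDeriv (fun x => ∫ s in Iic x, f s) f := by
  intro p
  set q := (C 3 - X ^ 2) * p with hq
  have hq1 : q.eval √3 = 0 := by simp [hq]
  have hq2 : q.eval (-√3) = 0 := by simp [hq]
  have hprod : Integrable (Function.uncurry fun x s : ℝ =>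
      (Iic x).indicator (fun s => (derivative q).eval x • f s) s)
      ((volume.restrict Ixi).prod volume) := by
    have h1 := (integrable_eval (derivative q)).smul_prod hf
    have h2 := h1.indicator (s := {z : ℝ × ℝ | z.2 ≤ z.1})
      (measurableSet_le measurable_snd measurable_fst)
    refine h2.congr (ae_of_all _ fun z => ?_)
    simp only [indicator, mem_ofPred_eq, Function.uncurry, mem_Iic]
  have hswap := integral_integral_swap hprod
  have hl : ∀ x, ∫ s, (Iic x).indicator (fun s => (derivative q).eval x • f s) s =
      (derivative q).eval x • ∫ s in Iic x, f s := by
    intro x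
    rw [integral_indicator measurableSet_Iic, integral_smul]
  have hinner : ∀ s, ∫ x in Ixi, (Iic x).indicator (fun s => (derivative q).eval x • f s) s =
      Ixi.indicator (fun s => -(q.eval s • f s)) s := by
    intro s
    have h1 : ∀ x, (Iic x).indicator (fun s => (derivative q).eval x • f s) s =
        (Ici s).indicator (fun x => (derivative q).eval x • f s) x := by
      intro x
      simp only [indicator, mem_Iic, mem_Ici]
    simp_rw [h1]
    rw [setIntegral_indicator measurableSet_Ici, integral_smul_const]
    have hset : Ixi ∩ Ici s = Icc (max (-√3) s) √3 := by
      ext x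
      simp only [Ixi, mem_inter_iff, mem_Icc, mem_Ici, max_le_iff]
      tauto
    rw [hset]
    by_cases hs : s ≤ √3
    · rw [integral_Icc_eq_integral_Ioc, ← intervalIntegral.integral_of_le
        (max_le (by linarith [sqrt_three_pos]) hs),
        intervalIntegral.integral_eq_sub_of_hasDerivAt (f := fun z => q.eval z)
          (fun x _ => q.hasDerivAt x) ((derivative q).continuous.intervalIntegrable _ _), hq1,
        zero_sub]
      by_cases hs' : -√3 ≤ s
      · rw [max_eq_right hs', indicator_of_mem (mem_Ixi.2 ⟨hs', hs⟩), neg_smul]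
      · rw [max_eq_left (not_le.1 hs').le, hq2,
          indicator_of_notMem fun h => hs' (mem_Ixi.1 h).1]
        simp
    · rw [Icc_eq_empty (fun h => hs ((le_max_right _ _).trans h)),
        indicator_of_notMem fun h => hs (mem_Ixi.1 h).2]
      simp
  simp_rw [hl, hinner] at hswap
  rw [hswap, integral_indicator measurableSet_Ixi, integral_neg]

lemma setIntegral_Iic_comp_mul_add {g : ℝ → State n} {ρ : ℝ} (hρ : 0 < ρ) (b x : ℝ) :
    ∫ s in Iic x, ρ • g (ρ * s + b) = ∫ t in Iic (ρ * x + b), g t := by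
  rw [← integral_indicator measurableSet_Iic, ← integral_indicator measurableSet_Iic]
  set G := (Iic (ρ * x + b)).indicator g
  have h1 : ∀ s, (Iic x).indicator (fun s => ρ • g (ρ * s + b)) s = ρ • G (ρ * s + b) := by
    intro s
    have : ρ * s + b ≤ ρ * x + b ↔ s ≤ x := by
      rw [add_le_add_iff_right, mul_le_mul_iff_right₀ hρ]
    simp only [G, indicator, mem_Iic, this]
    split_ifs <;> simp
  simp_rw [h1]
  rw [integral_smul, Measure.integral_comp_mul_left (fun t => G (t + b)) ρ,
    integral_add_right_eq_self (fun t => G t) b, abs_of_pos (inv_pos.2 hρ), smul_smul,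
    mul_inv_cancel₀ hρ.ne', one_smul]

lemma lintegral_comp_mul_add {F : ℝ → ENNReal} (hF : Measurable F) {ρ : ℝ} (hρ : 0 < ρ)
    (b : ℝ) : ∫⁻ x, F (ρ * x + b) = ENNReal.ofReal ρ⁻¹ * ∫⁻ x, F x := by
  have h1 := lintegral_map (μ := volume) (f := fun t => F (t + b)) (g := fun x => ρ * x)
    (by fun_prop) (by fun_prop)
  rw [← h1, Real.map_volume_mul_left hρ.ne', lintegral_smul_measure, abs_of_pos (inv_pos.2 hρ),
    lintegral_add_right_eq_self F b]
  rfl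

lemma memLp_two_of_lintegral_ne_top {v : ℝ → State n}
    (hv : AEStronglyMeasurable v (volume.restrict Ixi)) (h : ∫⁻ z in Ixi, ‖v z‖ₑ ^ 2 ≠ ⊤) :
    MemLp v 2 (volume.restrict Ixi) := by
  refine ⟨hv, (eLpNorm_lt_top_iff_lintegral_rpow_enorm_lt_top two_ne_zero (by simp)).2 ?_⟩
  simpa using h.lt_top

/-- A function of finite Gagliardo seminorm `S` is approximated, at scale `h`, by its moving
averages `gh`: the error is `O(h ^ θ)` and the derivative is `O(h ^ (θ - 1))`. The centre of the
averaging window is moved by an affine map so that the window stays inside `I_ξ`. -/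
lemma exists_smoothing {θ : ℝ} (hθ : 0 ≤ θ) {g : ℝ → State n} (hg : Measurable g)
    (hgi : Integrable g) (hg2 : MemLp g 2 (volume.restrict Ixi)) {S : ℝ} (hS0 : 0 ≤ S)
    (hS : gagliardo θ g ≤ ENNReal.ofReal (S ^ 2)) {h : ℝ} (hh : 0 < h) (hh1 : h ≤ 1) :
    ∃ gh f : ℝ → State n, MemLp gh 2 (volume.restrict Ixi) ∧ MemLp f 2 (volume.restrict Ixi) ∧
      HasPolyWeakDeriv gh f ∧ l2Norm (fun z => g z - gh z) ≤ h ^ θ * S ∧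
      l2Norm f ≤ 2 * h ^ (θ - 1) * S := by
  have h3 := sqrt_three_pos
  have h31 : 1 ≤ √3 := Real.one_le_sqrt.2 (by norm_num)
  set ρ : ℝ := 1 - h / (2 * √3) with hρ
  have hsmall : h / (2 * √3) ≤ 1 / 2 := by
    rw [div_le_div_iff₀ (by positivity) (by norm_num)]
    nlinarith
  have hρ0 : 0 < ρ := by linarith
  have hρ1 : ρ ≤ 1 := by
    have : 0 ≤ h / (2 * √3) := by positivity
    linarith
  have hρ3 : ρ * √3 = √3 - h / 2 := by
    rw [hρ]
    field_simp
  -- the window `(ρ x - h / 2, ρ x + h / 2]` contains `x` and is contained in `I_ξ`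
  set Q := gagliardoDensity θ g with hQ
  have hQm : Measurable Q := measurable_gagliardoDensity hg
  have hQint : ∫⁻ x in Ixi, Q x ≤ ENNReal.ofReal (S ^ 2) := hS
  have hwin : ∀ x ∈ Ixi, -√3 ≤ ρ * x - h / 2 ∧ ρ * x + h / 2 ≤ √3 := by
    intro x hx
    have h1 := mul_le_mul_of_nonneg_left (mem_Ixi.1 hx).1 hρ0.le
    have h2 := mul_le_mul_of_nonneg_left (mem_Ixi.1 hx).2 hρ0.le
    constructor <;> linarith
  have hmem : ∀ x ∈ Ixi, ρ * x - h / 2 ≤ x ∧ x ≤ ρ * x + h / 2 := by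
    intro x hx
    have h1 : x - ρ * x = h / (2 * √3) * x := by rw [hρ]; ring
    have h0 : 0 ≤ h / (2 * √3) := by positivity
    have h2 := mul_le_mul_of_nonneg_left (mem_Ixi.1 hx).1 h0
    have h4 := mul_le_mul_of_nonneg_left (mem_Ixi.1 hx).2 h0
    have h5 : h / (2 * √3) * √3 = h / 2 := by field_simp
    constructor <;> linarith
  set gh : ℝ → State n := fun x => h⁻¹ • ∫ t in Ioc (ρ * x - h / 2) (ρ * x - h / 2 + h), g t
    with hgh
  set f : ℝ → State n := fun x => h⁻¹ • (ρ • g (ρ * x + h / 2) - ρ • g (ρ * x + -(h / 2)))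
    with hf
  have hgcomp : ∀ b : ℝ, Integrable fun x => ρ • g (ρ * x + b) := by
    intro b
    have h1 : Integrable fun t => g (t + b) := hgi.comp_add_right b
    exact (h1.comp_mul_left' hρ0.ne').smul ρ
  have hfi : Integrable f := ((hgcomp (h / 2)).sub (hgcomp (-(h / 2)))).smul h⁻¹
  have hghf : gh = fun x => ∫ s in Iic x, f s := by
    funext x
    have h1 : ∫ s in Iic x, f s = h⁻¹ • (∫ s in Iic x, ρ • g (ρ * s + h / 2) -
        ρ • g (ρ * s + -(h / 2))) := integral_smul _ _
    have h2 : ∫ s in Iic x, (ρ • g (ρ * s + h / 2) - ρ • g (ρ * s + -(h / 2))) =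
        (∫ s in Iic x, ρ • g (ρ * s + h / 2)) - ∫ s in Iic x, ρ • g (ρ * s + -(h / 2)) :=
      integral_sub (hgcomp _).integrableOn (hgcomp _).integrableOn
    rw [h1, h2, setIntegral_Iic_comp_mul_add hρ0, setIntegral_Iic_comp_mul_add hρ0,
      intervalIntegral.integral_Iic_sub_Iic hgi.integrableOn hgi.integrableOn,
      intervalIntegral.integral_of_le (by linarith)]
    simp only [hgh]
    congr 4
    ring
  have hghc : Continuous gh := by
    have h1 : gh = fun x => (∫ s in Iic (0 : ℝ), f s) + ∫ s in (0 : ℝ)..x, f s := by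
      rw [hghf]
      funext x
      rw [← intervalIntegral.integral_Iic_sub_Iic hfi.integrableOn hfi.integrableOn]
      abel
    rw [h1]
    exact continuous_const.add
      (intervalIntegral.continuous_primitive (fun a b => hfi.intervalIntegrable) 0)
  have hghm : MemLp gh 2 (volume.restrict Ixi) := memLp_of_continuousOn hghc.continuousOn
  have hθ2 : (h ^ θ) ^ 2 = h ^ (2 * θ) := by
    rw [← Real.rpow_natCast, ← Real.rpow_mul hh.le]
    congr 1
    push_cast
    ring
  -- the approximation error
  have herr : ∫⁻ z in Ixi, ‖g z - gh z‖ₑ ^ 2 ≤ ENNReal.ofReal ((h ^ θ * S) ^ 2) := by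
    calc ∫⁻ z in Ixi, ‖g z - gh z‖ₑ ^ 2
        ≤ ∫⁻ z in Ixi, ENNReal.ofReal (h ^ (2 * θ)) * Q z := by
          refine setLIntegral_mono' measurableSet_Ixi fun z hz => ?_
          refine enorm_sub_average_sq_le hθ hg hgi hh (fun t ht => ?_) (hmem z hz).1 ?_
          · have := hwin z hz
            exact ⟨by linarith [ht.1], by linarith [ht.2]⟩
          · linarith [(hmem z hz).2]
      _ = ENNReal.ofReal (h ^ (2 * θ)) * ∫⁻ z in Ixi, Q z := lintegral_const_mul _ hQm
      _ ≤ ENNReal.ofReal (h ^ (2 * θ)) * ENNReal.ofReal (S ^ 2) := mul_le_mul_right hQint _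
      _ = _ := by rw [← ENNReal.ofReal_mul (by positivity), mul_pow, hθ2]
  -- the derivative
  have hcomp : ∀ b : ℝ, ∫⁻ x in Ixi, Ixi.indicator Q (ρ * x + b) ≤
      ENNReal.ofReal (ρ⁻¹ * S ^ 2) := by
    intro b
    calc ∫⁻ x in Ixi, Ixi.indicator Q (ρ * x + b)
        ≤ ∫⁻ x, Ixi.indicator Q (ρ * x + b) := setLIntegral_le_lintegral _ _
      _ = ENNReal.ofReal ρ⁻¹ * ∫⁻ x in Ixi, Q x := by
          rw [lintegral_comp_mul_add (hQm.indicator measurableSet_Ixi) hρ0,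
            lintegral_indicator measurableSet_Ixi]
      _ ≤ _ := by
          rw [ENNReal.ofReal_mul (by positivity)]
          exact mul_le_mul_right hQint _
  have hfb : ∫⁻ z in Ixi, ‖f z‖ₑ ^ 2 ≤ ENNReal.ofReal ((2 * h ^ (θ - 1) * S) ^ 2) := by
    set A : ℝ := (h⁻¹ * ρ) ^ 2 * 2 * h ^ (2 * θ) with hA
    have hA0 : 0 ≤ A := by positivity
    calc ∫⁻ z in Ixi, ‖f z‖ₑ ^ 2
        ≤ ∫⁻ z in Ixi, ENNReal.ofReal A * (Ixi.indicator Q (ρ * z + h / 2) +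
            Ixi.indicator Q (ρ * z + -(h / 2))) := by
          refine setLIntegral_mono' measurableSet_Ixi fun z hz => ?_
          have hw := hwin z hz
          have hsub : Ioc (ρ * z - h / 2) (ρ * z - h / 2 + h) ⊆ Ixi := fun t ht =>
            ⟨by linarith [ht.1], by linarith [ht.2]⟩
          have h1 := enorm_sub_average_sq_le hθ hg hgi hh hsub
            (x := ρ * z + h / 2) (by linarith) (by linarith)
          have h2 := enorm_sub_average_sq_le hθ hg hgi hh hsub
            (x := ρ * z + -(h / 2)) (by linarith) (by linarith)
          have h4 := enorm_sub_sq_le (g (ρ * z + h / 2)) (g (ρ * z + -(h / 2))) (gh z)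
          have hi : ‖h⁻¹ * ρ‖ₑ = ENNReal.ofReal (h⁻¹ * ρ) :=
            Real.enorm_of_nonneg (by positivity)
          have hfz : f z = (h⁻¹ * ρ) • (g (ρ * z + h / 2) - g (ρ * z + -(h / 2))) := by
            simp only [hf]
            rw [← smul_sub, smul_smul]
          rw [indicator_of_mem (mem_Ixi.2 ⟨by linarith, by linarith⟩),
            indicator_of_mem (mem_Ixi.2 ⟨by linarith, by linarith⟩), hfz, enorm_smul, mul_pow,
            hi, ← ENNReal.ofReal_pow (by positivity), hA, mul_assoc ((h⁻¹ * ρ) ^ 2),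
            ENNReal.ofReal_mul (sq_nonneg _), mul_assoc]
          refine mul_le_mul_right (h4.trans ?_) _
          rw [ENNReal.ofReal_mul (by norm_num), ENNReal.ofReal_ofNat, mul_assoc,
            mul_add (ENNReal.ofReal (h ^ (2 * θ)))]
          exact mul_le_mul_right (add_le_add h1 h2) _
      _ = ENNReal.ofReal A * ((∫⁻ z in Ixi, Ixi.indicator Q (ρ * z + h / 2)) +
            ∫⁻ z in Ixi, Ixi.indicator Q (ρ * z + -(h / 2))) := by
          have hm : ∀ b : ℝ, Measurable fun z => Ixi.indicator Q (ρ * z + b) := fun b =>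
            (hQm.indicator measurableSet_Ixi).comp (by fun_prop)
          rw [lintegral_const_mul _ ((hm (h / 2)).fun_add (hm (-(h / 2)))),
            lintegral_add_left (hm _)]
      _ ≤ ENNReal.ofReal A *
            (ENNReal.ofReal (ρ⁻¹ * S ^ 2) + ENNReal.ofReal (ρ⁻¹ * S ^ 2)) :=
          mul_le_mul_right (add_le_add (hcomp _) (hcomp _)) _
      _ ≤ ENNReal.ofReal ((2 * h ^ (θ - 1) * S) ^ 2) := by
          rw [← ENNReal.ofReal_add (by positivity) (by positivity),
            ← ENNReal.ofReal_mul hA0]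
          refine ENNReal.ofReal_le_ofReal ?_
          have h5 : A * (ρ⁻¹ * S ^ 2 + ρ⁻¹ * S ^ 2) = ρ * (2 * h ^ (θ - 1) * S) ^ 2 := by
            rw [Real.rpow_sub hh, Real.rpow_one, hA, ← hθ2]
            field_simp
            ring
          rw [h5]
          exact mul_le_of_le_one_left (sq_nonneg _) hρ1
  have hfm : MemLp f 2 (volume.restrict Ixi) :=
    memLp_two_of_lintegral_ne_top hfi.integrableOn.1
      (hfb.trans_lt ENNReal.ofReal_lt_top).ne
  refine ⟨gh, f, hghm, hfm, ?_, ?_, ?_⟩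
  · rw [hghf]
    exact hasPolyWeakDeriv_integral_Iic hfi
  · exact l2Norm_le_of_lintegral_le (by positivity) (hg2.sub hghm) herr
  · exact l2Norm_le_of_lintegral_le (by positivity) hfm hfb

namespace IsOrthonormalBasis

variable {φ : ℕ → ℝ[X]} (hφ : IsOrthonormalBasis φ)
include hφ

/-- The error of best approximation of a function of fractional smoothness. -/
lemma exists_l2Norm_sub_le_of_gagliardo {θ : ℝ} (hθ : 0 ≤ θ) {g : ℝ → State n}
    (hg : MemLp g 2 (volume.restrict Ixi)) (hfin : gagliardo θ g < ⊤) :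
    ∃ C : ℝ, 0 ≤ C ∧ ∀ N : ℕ,
      l2Norm (fun z => g z - toPoly φ (legendreCoeff φ N g) z) ≤ C * ((N : ℝ) + 1) ^ (-θ) := by
  -- a representative that is measurable and integrable on the whole line
  set g' : ℝ → State n := Ixi.indicator (hg.1.mk g) with hg'
  have hae : g =ᵐ[volume.restrict Ixi] g' := by
    filter_upwards [hg.1.ae_eq_mk, ae_restrict_mem measurableSet_Ixi] with z hz hzI
    rw [hg', indicator_of_mem hzI, hz]
  have hm : Measurable g' := hg.1.stronglyMeasurable_mk.measurable.indicator measurableSet_Ixi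
  have hg2 : MemLp g' 2 (volume.restrict Ixi) := hg.ae_eq hae
  have hgi : Integrable g' := by
    rw [hg', integrable_indicator_iff measurableSet_Ixi]
    exact (integrable_of_memLp hg).congr hg.1.ae_eq_mk
  set S : ℝ := √(gagliardo θ g').toReal with hS
  have hS0 : 0 ≤ S := Real.sqrt_nonneg _
  have hSle : gagliardo θ g' ≤ ENNReal.ofReal (S ^ 2) := by
    rw [hS, Real.sq_sqrt ENNReal.toReal_nonneg, ENNReal.ofReal_toReal]
    rw [← gagliardo_congr_ae hae]
    exact hfin.ne
  refine ⟨(1 + √3 * 2) * S, by positivity, fun N => ?_⟩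
  have hN : (0 : ℝ) < (N : ℝ) + 1 := by positivity
  obtain ⟨gh, f, hgh, hf, hd, h1, h2⟩ := exists_smoothing hθ hm hgi hg2 hS0 hSle
    (h := ((N : ℝ) + 1)⁻¹) (by positivity) (inv_le_one_of_one_le₀ (by linarith))
  have h3 := hφ.l2Norm_sub_le_of_hasPolyWeakDeriv hgh hf hd N
  have hm' : MemLp (fun z => g z - toPoly φ (legendreCoeff φ N gh) z) 2 (volume.restrict Ixi) :=
    hg.sub (memLp_toPoly φ _)
  have h4 : l2Norm (fun z => g z - gh z) = l2Norm (fun z => g' z - gh z) :=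
    l2Norm_congr_ae (hae.sub (ae_eq_refl gh))
  rw [Real.inv_rpow hN.le, ← Real.rpow_neg hN.le] at h1 h2
  calc l2Norm (fun z => g z - toPoly φ (legendreCoeff φ N g) z)
      ≤ l2Norm (fun z => g z - toPoly φ (legendreCoeff φ N gh) z) :=
        hφ.l2Norm_sub_toPoly_legendreCoeff_le hg _
    _ ≤ l2Norm (fun z => g z - gh z) + l2Norm (fun z => gh z - toPoly φ (legendreCoeff φ N gh) z) :=
        l2Norm_sub_le_add hg hgh (memLp_toPoly φ _)
    _ ≤ ((N : ℝ) + 1) ^ (-θ) * S + √3 / (N + 1) * (2 * ((N : ℝ) + 1) ^ (-(θ - 1)) * S) := by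
        rw [h4]
        exact add_le_add h1 (h3.trans (mul_le_mul_of_nonneg_left h2 (by positivity)))
    _ = _ := by
        rw [show -(θ - 1) = -θ + 1 by ring, Real.rpow_add hN, Real.rpow_one]
        field_simp

end IsOrthonormalBasis

/-! ### Convergence rates for functions in `H^s` -/

/-- A geometrically convergent sequence of continuous functions with `L²` limit `u` converges
to `u` everywhere. -/
lemma norm_sub_le_of_geometric {u : ℝ → State n} (hu : ContinuousOn u Ixi)
    {p : ℕ → ℝ → State n} (hp : ∀ j, Continuous (p j))
    (hlim : Tendsto (fun j => l2Norm (fun z => u z - p j z)) atTop (nhds 0)) {K r : ℝ}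
    (hK : 0 ≤ K) (hr0 : 0 ≤ r) (hr : r < 1)
    (hgeo : ∀ j, ∀ z ∈ Ixi, dist (p j z) (p (j + 1) z) ≤ K * r ^ j) {z : ℝ} (hz : z ∈ Ixi) :
    ‖u z - p 0 z‖ ≤ K / (1 - r) := by
  have hex : ∀ z ∈ Ixi, ∃ y, Tendsto (fun j => p j z) atTop (nhds y) := fun z hz =>
    cauchySeq_tendsto_of_complete (cauchySeq_of_le_geometric r K hr fun j => hgeo j z hz)
  choose! v hv using hex
  have hdist : ∀ j, ∀ z ∈ Ixi, dist (p j z) (v z) ≤ K * r ^ j / (1 - r) := fun j z hz =>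
    dist_le_of_le_geometric_of_tendsto r K hr (fun j => hgeo j z hz) (hv z hz) j
  have h0 : Tendsto (fun j : ℕ => K * r ^ j / (1 - r)) atTop (nhds 0) := by
    have := ((tendsto_pow_atTop_nhds_zero_of_lt_one hr0 hr).const_mul K).div_const (1 - r)
    simpa using this
  have hunif : TendstoUniformlyOn p v atTop Ixi := by
    rw [Metric.tendstoUniformlyOn_iff]
    intro ε hε
    filter_upwards [h0.eventually_lt_const hε] with j hj z hz
    rw [dist_comm]
    exact (hdist j z hz).trans_lt hj
  have hvc : ContinuousOn v Ixi :=
    hunif.continuousOn (Frequently.of_forall fun j => (hp j).continuousOn)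
  have hzero : l2Norm (fun z => u z - v z) = 0 := by
    refine le_antisymm ?_ (l2Norm_nonneg _)
    have hsum := hlim.add (h0.const_mul 2)
    rw [mul_zero, add_zero] at hsum
    refine ge_of_tendsto hsum (Eventually.of_forall fun j => ?_)
    have h1 := l2Norm_sub_le_add (memLp_of_continuousOn hu)
      (memLp_of_continuousOn (hp j).continuousOn) (memLp_of_continuousOn hvc)
    have h2 : l2Norm (fun z => p j z - v z) ≤ 2 * (K * r ^ j / (1 - r)) := by
      refine l2Norm_le_of_forall_norm_le ?_ fun z hz => ?_
      · have := sub_pos.2 hr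
        positivity
      · rw [← dist_eq_norm]
        exact hdist j z hz
    linarith
  rw [eqOn_of_l2Norm_sub_eq_zero hu hvc hzero hz, ← dist_eq_norm, dist_comm]
  simpa using hdist 0 z hz

namespace IsOrthonormalBasis

variable {φ : ℕ → ℝ[X]} (hφ : IsOrthonormalBasis φ)
include hφ

/-- The `L²` error of the least squares approximation of a function in `H^s`. -/
lemma exists_l2Norm_sub_le_of_memHs {s : ℝ} (hs : 1 < s) {u : ℝ → State n}
    (hu : MemLp u 2 (volume.restrict Ixi)) (hHs : MemHs s u) :
    ∃ C : ℝ, 0 ≤ C ∧ ∃ N₀ : ℕ, 1 ≤ N₀ ∧ ∀ N ≥ N₀,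
      l2Norm (fun z => u z - toPoly φ (legendreCoeff φ N u) z) ≤ C * (N : ℝ) ^ (-s) := by
  obtain ⟨g, hg, hgag⟩ := hHs
  set m := ⌊s⌋₊ with hm
  have hm1 : 1 ≤ m := Nat.le_floor (by simpa using hs.le)
  have hms : (m : ℝ) ≤ s := Nat.floor_le (by linarith)
  -- the weak derivatives of `u`, with `u` itself in place of the a.e. equal `g 0`
  set G : ℕ → ℝ → State n := fun k => if k = 0 then u else g k with hG
  have hGm : ∀ k ≤ m, MemLp (G k) 2 (volume.restrict Ixi) := by
    intro k hk
    by_cases h0 : k = 0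
    · simpa [hG, h0] using hu
    · simpa [hG, h0] using (hg k hk).2
  have hGw : ∀ k ≤ m, HasWeakDeriv k u (G k) := by
    intro k hk
    by_cases h0 : k = 0
    · subst h0
      exact hasWeakDeriv_zero_self u
    · simpa [hG, h0] using (hg k hk).1
  have hpair : ∀ k, k + 1 ≤ m → HasPolyWeakDeriv (G k) (G (k + 1)) := fun k hk =>
    ((hGw k (by omega)).one_of_succ (hGw (k + 1) hk)).hasPolyWeakDeriv
      (integrable_of_memLp (hGm k (by omega))) (integrable_of_memLp (hGm (k + 1) hk))
  -- the derivative of order `⌊s⌋` is approximated with the fractional order `s - ⌊s⌋`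
  obtain ⟨C, hC0, hC⟩ : ∃ C : ℝ, 0 ≤ C ∧ ∀ N : ℕ,
      l2Norm (fun z => G m z - toPoly φ (legendreCoeff φ N (G m)) z) ≤
        C * ((N : ℝ) + 1) ^ (-(s - m)) := by
    by_cases hne : (m : ℝ) = s
    · refine ⟨l2Norm (G m), l2Norm_nonneg _, fun N => ?_⟩
      have := hφ.l2Norm_sub_toPoly_legendreCoeff_le (N := N) (hGm m le_rfl) 0
      simpa [toPoly, hne] using this
    · have hGg : G m = g m := if_neg (by omega)
      refine hφ.exists_l2Norm_sub_le_of_gagliardo (sub_nonneg.2 hms) (hGm m le_rfl) ?_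
      rw [hGg]
      exact hgag hne
  -- each integration gains one order and raises the degree by one
  have hind : ∀ j ≤ m, ∀ N : ℕ,
      l2Norm (fun z => G (m - j) z - toPoly φ (legendreCoeff φ (N + j) (G (m - j))) z) ≤
        C * √3 ^ j * ((N : ℝ) + 1) ^ (-(s - m) - j) := by
    intro j
    induction j with
    | zero => intro _ N; simpa using hC N
    | succ j ih =>
      intro hj N
      have hN : (0 : ℝ) < (N : ℝ) + 1 := by positivity
      have hk : m - j = m - (j + 1) + 1 := by omega
      have h1 := ih (by omega) N
      rw [hk] at h1
      have h2 := hφ.l2Norm_sub_succ_le (hGm (m - (j + 1)) (by omega))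
        (hGm (m - (j + 1) + 1) (by omega)) (hpair _ (by omega))
        (legendreCoeff φ (N + j) (G (m - (j + 1) + 1)))
      refine h2.trans ((mul_le_mul_of_nonneg_left h1 (by positivity)).trans ?_)
      have h3 : √3 / (((N + j : ℕ) : ℝ) + 1) ≤ √3 / (N + 1) := by
        refine div_le_div_of_nonneg_left (by positivity) hN ?_
        push_cast
        linarith [(Nat.cast_nonneg j : (0 : ℝ) ≤ j)]
      refine (mul_le_mul_of_nonneg_right h3 (by positivity)).trans_eq ?_
      have h4 : -(s - m) - ((j + 1 : ℕ) : ℝ) = -(s - m) - j - 1 := by push_cast; ring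
      rw [h4, Real.rpow_sub hN _ 1, Real.rpow_one, pow_succ]
      field_simp
  refine ⟨C * √3 ^ m * ((m : ℝ) + 1) ^ s, by positivity, m, hm1, fun N hN => ?_⟩
  obtain ⟨k, rfl⟩ := Nat.exists_eq_add_of_le' hN
  have h1 := hind m le_rfl k
  have hk : (0 : ℝ) < (k : ℝ) + 1 := by positivity
  have hkm : (0 : ℝ) < ((k + m : ℕ) : ℝ) := by exact_mod_cast (by omega : 0 < k + m)
  rw [Nat.sub_self, show -(s - m) - m = -s by ring] at h1
  have h2 : ((k : ℝ) + 1) ^ (-s) ≤ ((m : ℝ) + 1) ^ s * ((k + m : ℕ) : ℝ) ^ (-s) := by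
    rw [Real.rpow_neg hk.le, Real.rpow_neg hkm.le, ← div_eq_mul_inv,
      ← Real.div_rpow (by positivity) hkm.le, ← Real.inv_rpow hk.le]
    refine Real.rpow_le_rpow (by positivity) ?_ (by linarith)
    rw [inv_eq_one_div, div_le_div_iff₀ hk hkm]
    push_cast
    nlinarith [(Nat.cast_nonneg k : (0 : ℝ) ≤ k), (Nat.cast_nonneg m : (0 : ℝ) ≤ m)]
  have h3 : G 0 = u := by simp [hG]
  rw [h3] at h1
  refine h1.trans ((mul_le_mul_of_nonneg_left h2 (by positivity)).trans_eq (by ring))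

/-- An `L²` rate better than `N⁻¹` gives uniform convergence: by the inverse inequality
the differences of the projections of degrees `2 ^ j N` are uniformly summable. -/
lemma exists_forall_norm_sub_lt {s C : ℝ} (hs : 1 < s) (hC : 0 ≤ C) {N₀ : ℕ} (hN₀ : 1 ≤ N₀)
    {u : ℝ → State n} (hu : ContinuousOn u Ixi)
    (hrate : ∀ N ≥ N₀,
      l2Norm (fun z => u z - toPoly φ (legendreCoeff φ N u) z) ≤ C * (N : ℝ) ^ (-s))
    {ε : ℝ} (hε : 0 < ε) :
    ∃ N₁ : ℕ, ∀ N ≥ N₁, ∀ z ∈ Ixi, ‖u z - toPoly φ (legendreCoeff φ N u) z‖ < ε := by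
  have hum := memLp_of_continuousOn hu
  set r : ℝ := 2 ^ (1 - s) with hr
  have hr0 : 0 < r := by positivity
  have hr1 : r < 1 := Real.rpow_lt_one_of_one_lt_of_neg (by norm_num) (by linarith)
  have hmain : ∀ N ≥ N₀, ∀ z ∈ Ixi, ‖u z - toPoly φ (legendreCoeff φ N u) z‖ ≤
      6 * C * (N : ℝ) ^ (1 - s) / (1 - r) := by
    intro N hN z hz
    have hN1 : (1 : ℝ) ≤ N := by exact_mod_cast hN₀.trans hN
    set p : ℕ → ℝ → State n := fun j => toPoly φ (legendreCoeff φ (2 ^ j * N) u) with hp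
    have hle : ∀ j, N₀ ≤ 2 ^ j * N := fun j => hN.trans (Nat.le_mul_of_pos_left N (by positivity))
    have hpm : ∀ j, MemLp (p j) 2 (volume.restrict Ixi) := fun j => memLp_toPoly φ _
    have hcast : ∀ j : ℕ, ((2 ^ j * N : ℕ) : ℝ) = 2 ^ j * N := fun j => by push_cast; ring
    have herr : ∀ j, l2Norm (fun z => u z - p j z) ≤ C * ((2 : ℝ) ^ j * N) ^ (-s) := by
      intro j
      have := hrate _ (hle j)
      rwa [hcast] at this
    have hlim : Tendsto (fun j => l2Norm (fun z => u z - p j z)) atTop (nhds 0) := by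
      have h1 : Tendsto (fun j : ℕ => ((2 : ℝ) ^ j * N)) atTop atTop :=
        (tendsto_pow_atTop_atTop_of_one_lt (by norm_num)).atTop_mul_const (by linarith)
      have h2 := ((tendsto_rpow_neg_atTop (by linarith : 0 < s)).comp h1).const_mul C
      rw [mul_zero] at h2
      exact squeeze_zero (fun _ => l2Norm_nonneg _) herr h2
    have hgeo : ∀ j, ∀ z ∈ Ixi, dist (p j z) (p (j + 1) z) ≤
        6 * C * (N : ℝ) ^ (1 - s) * r ^ j := by
      intro j z hz
      have hX : (1 : ℝ) ≤ 2 ^ j * N :=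
        one_le_mul_of_one_le_of_one_le (one_le_pow₀ (by norm_num)) hN1
      set Y : ℝ := 2 ^ j * N with hY
      obtain ⟨d, hd⟩ := hφ.exists_toPoly_eq_of_le
        (Nat.mul_le_mul_right N (Nat.pow_le_pow_right two_pos j.le_succ))
        (legendreCoeff φ (2 ^ j * N) u)
      have hdiff : ∀ y, toPoly φ (fun i => d i - legendreCoeff φ (2 ^ (j + 1) * N) u i) y =
          p j y - p (j + 1) y := by
        intro y
        rw [toPoly_sub, hd]
      have h1 := hφ.norm_toPoly_le (fun i => d i - legendreCoeff φ (2 ^ (j + 1) * N) u i) hz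
      have h2 : l2Norm (toPoly φ (fun i => d i - legendreCoeff φ (2 ^ (j + 1) * N) u i)) ≤
          2 * (C * Y ^ (-s)) := by
        rw [funext hdiff]
        have h3 := l2Norm_sub_le_add (hpm j) hum (hpm (j + 1))
        rw [l2Norm_sub_comm (p j) u] at h3
        have h4 := herr j
        have h5 := herr (j + 1)
        have h6 : ((2 : ℝ) ^ (j + 1) * N) ^ (-s) ≤ Y ^ (-s) := by
          refine Real.rpow_le_rpow_of_nonpos (by linarith) ?_ (by linarith)
          rw [hY, pow_succ]
          nlinarith
        nlinarith
      rw [hdiff, hcast] at h1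
      rw [dist_eq_norm]
      have h7 : (2 : ℝ) ^ (j + 1) * N + 1 ≤ 3 * Y := by
        rw [pow_succ]
        linarith
      have h8 : Y * Y ^ (-s) = (N : ℝ) ^ (1 - s) * r ^ j := by
        have h9 : Y * Y ^ (-s) = Y ^ (1 - s) := by
          rw [sub_eq_add_neg, Real.rpow_add (by linarith), Real.rpow_one]
        rw [h9, hY, Real.mul_rpow (by positivity) (by positivity), hr, mul_comm,
          ← Real.rpow_natCast, ← Real.rpow_natCast, ← Real.rpow_mul (by norm_num),
          ← Real.rpow_mul (by norm_num), mul_comm (j : ℝ)]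
      calc ‖p j z - p (j + 1) z‖ ≤ 3 * Y * (2 * (C * Y ^ (-s))) :=
            h1.trans (mul_le_mul h7 h2 (l2Norm_nonneg _) (by linarith))
        _ = 6 * C * (Y * Y ^ (-s)) := by ring
        _ = _ := by rw [h8]; ring
    have := norm_sub_le_of_geometric hu (fun j => continuous_toPoly φ _) hlim (by positivity)
      hr0.le hr1 hgeo hz
    have hp0 : p 0 = toPoly φ (legendreCoeff φ N u) :=
      congrArg (fun M => toPoly φ (legendreCoeff φ M u)) (by simp : 2 ^ 0 * N = N)
    rw [← hp0]
    exact this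
  have hlim : Tendsto (fun N : ℕ => 6 * C * (N : ℝ) ^ (1 - s) / (1 - r)) atTop (nhds 0) := by
    have h1 := (tendsto_rpow_neg_atTop (by linarith : 0 < s - 1)).comp
      (tendsto_natCast_atTop_atTop (R := ℝ))
    have h2 := (h1.const_mul (6 * C)).div_const (1 - r)
    simpa [Function.comp_def, neg_sub] using h2
  obtain ⟨N₁, hN₁⟩ := eventually_atTop.1 (hlim.eventually_lt_const hε)
  exact ⟨max N₀ N₁, fun N hN z hz => (hmain N (le_of_max_le_left hN) z hz).trans_lt
    (hN₁ N (le_of_max_le_right hN))⟩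

end IsOrthonormalBasis

/-! ### Strong monotonicity near the branch and the Galerkin equations -/

lemma param_mem {a b : ℝ} (hab : a < b) {z : ℝ} (hz : z ∈ Ixi) : param a b z ∈ Icc a b := by
  have h3 := sqrt_three_pos
  have h0 : 0 ≤ (b - a) / (2 * √3) := div_nonneg (by linarith) (by positivity)
  have h1 := mul_le_mul_of_nonneg_left (mem_Ixi.1 hz).1 h0
  have h2 := mul_le_mul_of_nonneg_left (mem_Ixi.1 hz).2 h0
  have h5 : (b - a) / (2 * √3) * √3 = (b - a) / 2 := by field_simp
  unfold param
  constructor <;> linarith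

lemma continuous_param (a b : ℝ) : Continuous (param a b) := by
  unfold param
  fun_prop

/-- In a tube around the branch the nonlinearity is Lipschitz and strongly monotone, because
its derivative stays within `lam / 2` of the derivative on the branch. -/
lemma exists_lipschitz_monotone {a b : ℝ} (hab : a < b) {f : State n → ℝ → State n}
    (hfdiff : ∀ μ ∈ Icc a b, Differentiable ℝ (fun u => f u μ))
    (hfcont : ContinuousOn (fun p : State n × ℝ => fderiv ℝ (fun u => f u p.2) p.1)
      (univ ×ˢ Icc a b))
    {ubar : ℝ → State n} (hubar : ContinuousOn ubar Ixi) {lam : ℝ} (hlam : 0 < lam)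
    (hpos : ∀ z ∈ Ixi, ∀ w : State n,
      lam * ‖w‖ ^ 2 ≤ inner ℝ (fderiv ℝ (fun u => f u (param a b z)) (ubar z) w) w) :
    ∃ ε L : ℝ, 0 < ε ∧ lam / 2 ≤ L ∧ ∀ z ∈ Ixi, ∀ u ∈ Metric.closedBall (ubar z) ε,
      ∀ v ∈ Metric.closedBall (ubar z) ε,
        ‖f u (param a b z) - f v (param a b z)‖ ≤ L * ‖u - v‖ ∧
        lam / 2 * ‖u - v‖ ^ 2 ≤
          inner ℝ (f u (param a b z) - f v (param a b z)) (u - v) := by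
  -- the derivative at `ubar z + v` as a function of `(v, z)`, uniformly continuous on a compact set
  set B : State n × ℝ → State n →L[ℝ] State n :=
    fun p => fderiv ℝ (fun u => f u (param a b p.2)) (ubar p.2 + p.1) with hB
  set K : Set (State n × ℝ) := Metric.closedBall 0 1 ×ˢ Ixi with hK
  have hKc : IsCompact K := (isCompact_closedBall 0 1).prod isCompact_Ixi
  have hBc : ContinuousOn B K := by
    refine hfcont.comp (f := fun p : State n × ℝ => (ubar p.2 + p.1, param a b p.2)) ?_ ?_
    · refine ContinuousOn.prodMk ?_ ((continuous_param a b).comp continuous_snd).continuousOn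
      exact (hubar.comp continuousOn_snd fun p hp => hp.2).add continuousOn_fst
    · exact fun p hp => ⟨mem_univ _, param_mem hab hp.2⟩
  obtain ⟨M, hM⟩ := hKc.exists_bound_of_continuousOn hBc
  have hunif := hKc.uniformContinuousOn_of_continuous hBc
  obtain ⟨δ, hδ, hδB⟩ := Metric.uniformContinuousOn_iff_le.1 hunif (lam / 2) (by positivity)
  refine ⟨min δ 1, |M| + lam / 2, lt_min hδ one_pos, by linarith [abs_nonneg M],
    fun z hz u hu v hv => ?_⟩
  set A := fderiv ℝ (fun u => f u (param a b z)) (ubar z) with hA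
  have h0K : ((0 : State n), z) ∈ K := ⟨Metric.mem_closedBall_self zero_le_one, hz⟩
  have hAM : ‖A‖ ≤ |M| := by
    have := hM _ h0K
    simp only [hB, add_zero] at this
    exact this.trans (le_abs_self M)
  have hclose : ∀ x ∈ Metric.closedBall (ubar z) (min δ 1),
      ‖fderiv ℝ (fun u => f u (param a b z)) x - A‖ ≤ lam / 2 := by
    intro x hx
    have hx' : ‖x - ubar z‖ ≤ min δ 1 := by simpa [dist_eq_norm] using hx
    have hxK : (x - ubar z, z) ∈ K :=
      ⟨by simpa using hx'.trans (min_le_right _ _), hz⟩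
    have := hδB _ hxK _ h0K (by simpa [Prod.dist_eq] using hx'.trans (min_le_left _ _))
    rw [dist_eq_norm] at this
    simpa [hB] using this
  have hmv : ‖f u (param a b z) - f v (param a b z) - A (u - v)‖ ≤ lam / 2 * ‖u - v‖ :=
    (convex_closedBall (ubar z) (min δ 1)).norm_image_sub_le_of_norm_hasFDerivWithin_le'
      (f := fun u => f u (param a b z)) (f' := fderiv ℝ fun u => f u (param a b z))
      (fun x _ => ((hfdiff _ (param_mem hab hz)) x).hasFDerivAt.hasFDerivWithinAt) hclose hv hu
  constructor
  · have h1 := norm_add_le (f u (param a b z) - f v (param a b z) - A (u - v)) (A (u - v))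
    rw [sub_add_cancel] at h1
    have h2 := (A.le_opNorm (u - v)).trans
      (mul_le_mul_of_nonneg_right hAM (norm_nonneg (u - v)))
    linarith
  · have h1 := abs_le.1 (abs_real_inner_le_norm
      (f u (param a b z) - f v (param a b z) - A (u - v)) (u - v))
    have h2 := mul_le_mul_of_nonneg_right hmv (norm_nonneg (u - v))
    have h3 := hpos z hz (u - v)
    have h4 := inner_sub_left (𝕜 := ℝ) (f u (param a b z) - f v (param a b z)) (A (u - v)) (u - v)
    rw [h4] at h1
    nlinarith [h1.1]

/-- A strongly monotone Lipschitz field which is small at the centre of a ball has a zero in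
the ball: `x ↦ x - τ G x` is a contraction for `τ = κ / L²`. -/
lemma exists_zero_of_strongly_monotone {X : Type*} [NormedAddCommGroup X]
    [InnerProductSpace ℝ X] [CompleteSpace X] {G : X → X} {w : X} {r κ L : ℝ} (hr : 0 ≤ r)
    (hκ : 0 < κ) (hκL : κ ≤ L)
    (hlip : ∀ x ∈ Metric.closedBall w r, ∀ y ∈ Metric.closedBall w r,
      ‖G x - G y‖ ≤ L * ‖x - y‖)
    (hmono : ∀ x ∈ Metric.closedBall w r, ∀ y ∈ Metric.closedBall w r,
      κ * ‖x - y‖ ^ 2 ≤ inner ℝ (G x - G y) (x - y))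
    (hw : κ / L ^ 2 * ‖G w‖ ≤ (1 - √(1 - (κ / L) ^ 2)) * r) :
    ∃ x ∈ Metric.closedBall w r, G x = 0 := by
  have hL : 0 < L := hκ.trans_le hκL
  have hτ : 0 < κ / L ^ 2 := by positivity
  set τ := κ / L ^ 2 with hτd
  set q := √(1 - (κ / L) ^ 2) with hq
  have hq2 : q ^ 2 = 1 - (κ / L) ^ 2 := by
    refine Real.sq_sqrt (sub_nonneg.2 (pow_le_one₀ (by positivity) ?_))
    exact (div_le_one hL).2 hκL
  have hq0 : 0 ≤ q := Real.sqrt_nonneg _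
  have hq1 : q < 1 := by
    have : 0 < (κ / L) ^ 2 := by positivity
    nlinarith
  set T : X → X := fun x => x - τ • G x with hT
  have hcontr : ∀ x ∈ Metric.closedBall w r, ∀ y ∈ Metric.closedBall w r,
      ‖T x - T y‖ ≤ q * ‖x - y‖ := by
    intro x hx y hy
    have h1 : T x - T y = (x - y) - τ • (G x - G y) := by
      simp only [hT, smul_sub]
      abel
    refine abs_le_of_sq_le_sq' ?_ (by positivity) |>.2
    rw [h1, norm_sub_sq_real, inner_smul_right, real_inner_comm, norm_smul, mul_pow, mul_pow,
      Real.norm_eq_abs, sq_abs, hq2]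
    have h2 := pow_le_pow_left₀ (norm_nonneg _) (hlip x hx y hy) 2
    have h3 := hmono x hx y hy
    have h4 := mul_le_mul_of_nonneg_left h2 (sq_nonneg τ)
    have h5 := mul_le_mul_of_nonneg_left h3 hτ.le
    have h6 : τ ^ 2 * (L * ‖x - y‖) ^ 2 = (κ / L) ^ 2 * ‖x - y‖ ^ 2 := by
      rw [hτd]
      field_simp
    have h7 : τ * (κ * ‖x - y‖ ^ 2) = (κ / L) ^ 2 * ‖x - y‖ ^ 2 := by
      rw [hτd]
      field_simp
    nlinarith
  have hwb : w ∈ Metric.closedBall w r := Metric.mem_closedBall_self hr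
  have hmaps : MapsTo T (Metric.closedBall w r) (Metric.closedBall w r) := by
    intro x hx
    have h1 := hcontr x hx w hwb
    have h2 : ‖T w - w‖ = τ * ‖G w‖ := by
      simp [hT, norm_smul, abs_of_pos hτ]
    have h3 := norm_add_le (T x - T w) (T w - w)
    rw [sub_add_sub_cancel] at h3
    have hx' : ‖x - w‖ ≤ r := by simpa [dist_eq_norm] using hx
    have h4 := mul_le_mul_of_nonneg_left hx' hq0
    rw [Metric.mem_closedBall, dist_eq_norm]
    linarith
  have hK : ContractingWith ⟨q, hq0⟩ (hmaps.restrict T _ _) := by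
    refine ⟨by exact_mod_cast hq1, LipschitzWith.of_dist_le_mul fun x y => ?_⟩
    rw [Subtype.dist_eq, Subtype.dist_eq, dist_eq_norm, dist_eq_norm]
    exact hcontr x x.2 y y.2
  obtain ⟨x, hx, hfix, -⟩ := hK.exists_fixedPoint' Metric.isClosed_closedBall.isComplete hmaps
    hwb (edist_ne_top _ _)
  refine ⟨x, hx, ?_⟩
  have h1 : x - τ • G x = x := hfix
  have h2 : τ • G x = 0 := by simpa using h1
  exact (smul_eq_zero.1 h2).resolve_left hτ.ne'

lemma legendreCoeff_sub (φ : ℕ → ℝ[X]) {v w : ℝ → State n} (hv : IntegrableOn v Ixi)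
    (hw : IntegrableOn w Ixi) (i : Fin (N + 1)) :
    legendreCoeff φ N (fun z => v z - w z) i = legendreCoeff φ N v i - legendreCoeff φ N w i := by
  simp only [legendreCoeff, smul_sub]
  exact integral_sub (integrable_eval_smul _ hv) (integrable_eval_smul _ hw)

/-- Integrated strong monotonicity, for polynomials `c`, `d` and a nonlinearity with values `v`
along `c` and `w` along `d`. -/
lemma mul_l2Norm_sq_le_sum_inner {φ : ℕ → ℝ[X]} {c d : Fin (N + 1) → State n}
    {v w : ℝ → State n} {κ : ℝ} (hv : MemLp v 2 (volume.restrict Ixi))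
    (hw : MemLp w 2 (volume.restrict Ixi))
    (hmono : ∀ z ∈ Ixi, κ * ‖toPoly φ c z - toPoly φ d z‖ ^ 2 ≤
      inner ℝ (v z - w z) (toPoly φ c z - toPoly φ d z)) :
    κ * l2Norm (fun z => toPoly φ c z - toPoly φ d z) ^ 2 ≤
      ∑ i, inner ℝ (legendreCoeff φ N v i - legendreCoeff φ N w i) (c i - d i) := by
  have hvw : MemLp (fun z => v z - w z) 2 (volume.restrict Ixi) := hv.sub hw
  have hcd : MemLp (fun z => toPoly φ c z - toPoly φ d z) 2 (volume.restrict Ixi) :=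
    (memLp_toPoly φ c).sub (memLp_toPoly φ d)
  have h1 := integral_inner_toPoly φ (fun i => c i - d i) (integrable_of_memLp hvw)
  have h2 : ∀ i : Fin (N + 1), ∫ z in Ixi, (φ i).eval z • (v z - w z) =
      legendreCoeff φ N v i - legendreCoeff φ N w i :=
    legendreCoeff_sub φ (integrable_of_memLp hv) (integrable_of_memLp hw)
  simp_rw [h2, toPoly_sub] at h1
  rw [← h1, l2Norm_sq, ← integral_const_mul]
  refine integral_mono_ae ((integrable_norm_sq hcd).const_mul κ) (integrable_inner hvw hcd) ?_
  filter_upwards [ae_restrict_mem measurableSet_Ixi] with z hz using hmono z hz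

namespace IsOrthonormalBasis

variable {φ : ℕ → ℝ[X]} (hφ : IsOrthonormalBasis φ)
include hφ

/-- Bessel's inequality. -/
lemma l2Norm_toPoly_legendreCoeff_le {v : ℝ → State n} (hv : MemLp v 2 (volume.restrict Ixi)) :
    l2Norm (toPoly φ (legendreCoeff φ N v)) ≤ l2Norm v := by
  have h1 := integral_inner_le hv (memLp_toPoly φ (legendreCoeff φ N v))
  rw [integral_inner_toPoly φ _ (integrable_of_memLp hv)] at h1
  have h2 : l2Norm (toPoly φ (legendreCoeff φ N v)) ^ 2 ≤
      l2Norm v * l2Norm (toPoly φ (legendreCoeff φ N v)) := by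
    rw [hφ.l2Norm_toPoly_sq]
    simp_rw [← real_inner_self_eq_norm_sq]
    exact h1
  rw [sq] at h2
  rcases (l2Norm_nonneg (toPoly φ (legendreCoeff φ N v))).eq_or_lt with h | h
  · rw [← h]; exact l2Norm_nonneg _
  · exact le_of_mul_le_mul_right h2 h

lemma norm_toLp_eq (c : Fin (N + 1) → State n) :
    ‖(WithLp.toLp 2 c : PiLp 2 fun _ : Fin (N + 1) => State n)‖ = l2Norm (toPoly φ c) := by
  refine (pow_left_inj₀ (norm_nonneg _) (l2Norm_nonneg _) two_ne_zero).1 ?_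
  rw [PiLp.norm_sq_eq_of_L2, hφ.l2Norm_toPoly_sq]

/-- Solvability of the Galerkin equations in an `L²` ball of polynomials. -/
lemma exists_legendreCoeff_eq_zero {F : ℝ → State n → State n} {w : Fin (N + 1) → State n}
    {r κ L : ℝ} (hr : 0 ≤ r) (hκ : 0 < κ) (hκL : κ ≤ L)
    (hF : ∀ c : Fin (N + 1) → State n, ContinuousOn (fun z => F z (toPoly φ c z)) Ixi)
    (hlm : ∀ c d : Fin (N + 1) → State n, l2Norm (toPoly φ fun i => c i - w i) ≤ r →
      l2Norm (toPoly φ fun i => d i - w i) ≤ r → ∀ z ∈ Ixi,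
        ‖F z (toPoly φ c z) - F z (toPoly φ d z)‖ ≤ L * ‖toPoly φ c z - toPoly φ d z‖ ∧
        κ * ‖toPoly φ c z - toPoly φ d z‖ ^ 2 ≤
          inner ℝ (F z (toPoly φ c z) - F z (toPoly φ d z)) (toPoly φ c z - toPoly φ d z))
    (hw : κ / L ^ 2 * l2Norm (fun z => F z (toPoly φ w z)) ≤
      (1 - √(1 - (κ / L) ^ 2)) * r) :
    ∃ c : Fin (N + 1) → State n, l2Norm (toPoly φ fun i => c i - w i) ≤ r ∧
      legendreCoeff φ N (fun z => F z (toPoly φ c z)) = 0 := by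
  set H : (Fin (N + 1) → State n) → ℝ → State n := fun c z => F z (toPoly φ c z) with hH
  have hHm : ∀ c, MemLp (H c) 2 (volume.restrict Ixi) := fun c => memLp_of_continuousOn (hF c)
  set G : PiLp 2 (fun _ : Fin (N + 1) => State n) → PiLp 2 (fun _ : Fin (N + 1) => State n) :=
    fun x => WithLp.toLp 2 (legendreCoeff φ N (H x.ofLp)) with hG
  have hball : ∀ x ∈ Metric.closedBall (WithLp.toLp 2 w) r,
      l2Norm (toPoly φ fun i => x.ofLp i - w i) ≤ r := by
    intro x hx
    rw [Metric.mem_closedBall, dist_eq_norm] at hx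
    rw [← hφ.norm_toLp_eq]
    exact hx
  have hnorm : ∀ x y : PiLp 2 (fun _ : Fin (N + 1) => State n),
      ‖x - y‖ = l2Norm (fun z => toPoly φ x.ofLp z - toPoly φ y.ofLp z) := by
    intro x y
    have h1 : (fun z => toPoly φ x.ofLp z - toPoly φ y.ofLp z) =
        toPoly φ (fun i => x.ofLp i - y.ofLp i) := funext fun z => (toPoly_sub φ _ _ z).symm
    rw [h1, ← hφ.norm_toLp_eq]
    rfl
  suffices h : ∃ x ∈ Metric.closedBall (WithLp.toLp 2 w) r, G x = 0 by
    obtain ⟨x, hx, hx0⟩ := h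
    refine ⟨x.ofLp, hball x hx, ?_⟩
    have := congrArg WithLp.ofLp hx0
    simpa [hG] using this
  refine exists_zero_of_strongly_monotone hr hκ hκL (fun x hx y hy => ?_)
    (fun x hx y hy => ?_) ?_
  · have h1 : G x - G y = WithLp.toLp 2 (legendreCoeff φ N fun z => H x.ofLp z - H y.ofLp z) := by
      ext1 i
      change legendreCoeff φ N _ i - legendreCoeff φ N _ i = legendreCoeff φ N _ i
      rw [legendreCoeff_sub φ (integrable_of_memLp (hHm _)) (integrable_of_memLp (hHm _))]
    have hsub : MemLp (fun z => H x.ofLp z - H y.ofLp z) 2 (volume.restrict Ixi) :=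
      (hHm _).sub (hHm _)
    rw [h1, hφ.norm_toLp_eq, hnorm]
    refine (hφ.l2Norm_toPoly_legendreCoeff_le hsub).trans ?_
    exact l2Norm_le_mul (hκ.le.trans hκL) ((memLp_toPoly φ _).sub (memLp_toPoly φ _))
      fun z hz => (hlm _ _ (hball x hx) (hball y hy) z hz).1
  · rw [hnorm, PiLp.inner_apply]
    exact mul_l2Norm_sq_le_sum_inner (hHm _) (hHm _)
      fun z hz => (hlm _ _ (hball x hx) (hball y hy) z hz).2
  · refine le_trans (mul_le_mul_of_nonneg_left ?_ ?_) hw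
    · rw [hφ.norm_toLp_eq]
      exact hφ.l2Norm_toPoly_legendreCoeff_le (hHm _)
    · have := hκ.trans_le hκL
      positivity

end IsOrthonormalBasis

/-! ### Convergence of the Galerkin solutions -/

/-- Normalization of a polynomial chaos basis. -/
lemma IsPCBasis.exists_orthonormal {Φ : ℕ → ℝ[X]} (hΦ : IsPCBasis Φ) :
    ∃ (φ : ℕ → ℝ[X]) (ν : ℕ → ℝ), IsOrthonormalBasis φ ∧ (∀ k, 0 < ν k) ∧
      ∀ k, Φ k = C (ν k) * φ k := by
  have hpos : ∀ k, 0 < polyIntegral (Φ k * Φ k) := by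
    intro k
    have h0 : 0 ≤ polyIntegral (Φ k * Φ k) :=
      integral_nonneg fun z => by simpa using mul_self_nonneg ((Φ k).eval z)
    refine lt_of_le_of_ne h0 fun h => ?_
    have h1 := hΦ.degree_eq k
    rw [eq_zero_of_polyIntegral_mul_self h.symm, degree_zero] at h1
    simp at h1
  set ν : ℕ → ℝ := fun k => √(polyIntegral (Φ k * Φ k)) with hν
  have hν0 : ∀ k, 0 < ν k := fun k => Real.sqrt_pos.2 (hpos k)
  refine ⟨fun k => C (ν k)⁻¹ * Φ k, ν, ⟨fun k => ?_, fun i j => ?_⟩, hν0, fun k => ?_⟩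
  · rw [degree_C_mul (inv_ne_zero (hν0 k).ne'), hΦ.degree_eq]
  · rw [show C (ν i)⁻¹ * Φ i * (C (ν j)⁻¹ * Φ j) = ((ν i)⁻¹ * (ν j)⁻¹) • (Φ i * Φ j) by
      rw [smul_eq_C_mul, C_mul]; ring, map_smul, smul_eq_mul]
    split_ifs with hij
    · subst hij
      have : polyIntegral (Φ i * Φ i) = ν i ^ 2 := (Real.sq_sqrt (hpos i).le).symm
      rw [this]
      have := (hν0 i).ne'
      field_simp
    · have : polyIntegral (Φ i * Φ j) = 0 := by
        have := hΦ.orthogonal i j hij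
        simpa [polyIntegral_apply] using this
      rw [this, mul_zero]
  · rw [← mul_assoc, ← C_mul, mul_inv_cancel₀ (hν0 k).ne', C_1, one_mul]

section Rescaling

variable {Φ φ : ℕ → ℝ[X]} {ν : ℕ → ℝ} (hΦφ : ∀ k, Φ k = C (ν k) * φ k)
include hΦφ

lemma toPoly_of_eq_C_mul (c : Fin (N + 1) → State n) :
    toPoly Φ c = toPoly φ (fun i => ν i • c i) := by
  funext z
  simp only [toPoly, hΦφ, eval_mul, eval_C]
  refine Finset.sum_congr rfl fun i _ => ?_
  rw [smul_smul, mul_comm]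

lemma projCoeff_of_eq_C_mul (hφ : IsOrthonormalBasis φ) (hν : ∀ k, 0 < ν k) (v : ℝ → State n) :
    projCoeff Φ N v = fun i : Fin (N + 1) => (ν i)⁻¹ • legendreCoeff φ N v i := by
  funext i
  have h1 : ∫ z in Ixi, (Φ i).eval z ^ 2 = ν i ^ 2 := by
    have h := hφ.integral_mul i i
    rw [if_pos rfl, polyIntegral_apply] at h
    simp only [hΦφ, eval_mul, eval_C, mul_pow]
    rw [integral_const_mul]
    simp only [← sq, eval_pow] at h
    rw [h, mul_one]
  have h2 : ∫ z in Ixi, (Φ i).eval z • v z = ν i • legendreCoeff φ N v i := by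
    simp only [hΦφ, eval_mul, eval_C, mul_smul, legendreCoeff]
    exact integral_smul _ _
  rw [projCoeff, h1, h2, smul_smul]
  congr 1
  have := (hν i).ne'
  field_simp

lemma leastSquares_of_eq_C_mul (hφ : IsOrthonormalBasis φ) (hν : ∀ k, 0 < ν k)
    (v : ℝ → State n) : leastSquares Φ N v = toPoly φ (legendreCoeff φ N v) := by
  rw [leastSquares, toPoly_of_eq_C_mul hΦφ, projCoeff_of_eq_C_mul hΦφ hφ hν]
  congr 1
  funext i
  rw [smul_smul, mul_inv_cancel₀ (hν i).ne', one_smul]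

lemma projCoeff_eq_zero_iff (hφ : IsOrthonormalBasis φ) (hν : ∀ k, 0 < ν k) (v : ℝ → State n) :
    projCoeff Φ N v = 0 ↔ legendreCoeff φ N v = 0 := by
  rw [projCoeff_of_eq_C_mul hΦφ hφ hν, funext_iff, funext_iff]
  refine forall_congr' fun i => ?_
  simp [(hν i).ne']

end Rescaling

/-- The convergence theorem for the normalized basis, where the least squares approximation has
the Fourier coefficients of `ubar` as its coefficients. -/
lemma IsOrthonormalBasis.exists_galerkin_solutions {a b : ℝ} (hab : a < b)
    {f : State n → ℝ → State n}
    (hf : ContinuousOn (fun p : State n × ℝ => f p.1 p.2) (univ ×ˢ Icc a b))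
    (hfdiff : ∀ μ ∈ Icc a b, Differentiable ℝ (fun u => f u μ))
    (hfcont : ContinuousOn (fun p : State n × ℝ => fderiv ℝ (fun u => f u p.2) p.1)
      (univ ×ˢ Icc a b))
    {φ : ℕ → ℝ[X]} (hφ : IsOrthonormalBasis φ)
    {ubar : ℝ → State n} (hubar : ContinuousOn ubar Ixi)
    (hbranch : ∀ z ∈ Ixi, f (ubar z) (param a b z) = 0)
    {s : ℝ} (hs : 1 < s) (hHs : MemHs s ubar) {lam : ℝ} (hlam : 0 < lam)
    (hpos : ∀ z ∈ Ixi, ∀ w : State n,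
      lam * ‖w‖ ^ 2 ≤ inner ℝ (fderiv ℝ (fun u => f u (param a b z)) (ubar z) w) w) :
    ∃ (Nconv : ℕ) (ε A B D : ℝ), 0 < ε ∧ ∀ N ≥ Nconv, ∃ c : Fin (N + 1) → State n,
      legendreCoeff φ N (nemytskii f a b (toPoly φ c)) = 0 ∧
      (∀ z ∈ Ixi, ‖toPoly φ c z - toPoly φ (legendreCoeff φ N ubar) z‖ < ε) ∧
      (∀ d : Fin (N + 1) → State n, legendreCoeff φ N (nemytskii f a b (toPoly φ d)) = 0 →
        (∀ z ∈ Ixi, ‖toPoly φ d z - toPoly φ (legendreCoeff φ N ubar) z‖ < ε) → d = c) ∧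
      l2Norm (fun z => ubar z - toPoly φ c z) ≤
        A * l2Norm (nemytskii f a b (toPoly φ (legendreCoeff φ N ubar))) ∧
      l2Norm (nemytskii f a b (toPoly φ (legendreCoeff φ N ubar))) ≤
        B * l2Norm (fun z => ubar z - toPoly φ c z) ∧
      l2Norm (nemytskii f a b (toPoly φ (legendreCoeff φ N ubar))) ≤ D * (N : ℝ) ^ (-s) := by
  obtain ⟨ε₀, L, hε₀, hκL, htube⟩ := exists_lipschitz_monotone hab hfdiff hfcont hubar hlam hpos
  set κ := lam / 2 with hκ
  have hκ0 : 0 < κ := by positivity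
  have hL : 0 < L := hκ0.trans_le hκL
  have hum := memLp_of_continuousOn hubar
  have hFc : ∀ v : ℝ → State n, ContinuousOn v Ixi → ContinuousOn (nemytskii f a b v) Ixi := by
    intro v hv
    refine hf.comp (f := fun z => (v z, param a b z))
      (hv.prodMk (continuous_param a b).continuousOn) fun z hz => ⟨mem_univ _, param_mem hab hz⟩
  have hFp : ∀ {N : ℕ} (c : Fin (N + 1) → State n),
      MemLp (nemytskii f a b (toPoly φ c)) 2 (volume.restrict Ixi) := fun c =>
    memLp_of_continuousOn (hFc _ (continuous_toPoly φ c).continuousOn)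
  obtain ⟨C, hC0, N₀, hN₀, hrate⟩ := hφ.exists_l2Norm_sub_le_of_memHs hs hum hHs
  obtain ⟨N₁, hN₁⟩ := hφ.exists_forall_norm_sub_lt hs hC0 hN₀ hubar hrate (half_pos hε₀)
  set q := √(1 - (κ / L) ^ 2) with hq
  have hq1 : q < 1 := by
    have h1 : 0 < (κ / L) ^ 2 := by positivity
    exact (Real.sqrt_lt' one_pos).2 (by linarith)
  -- the residual is eventually small compared with the radius `ε₀ / (4 (N + 1))`
  obtain ⟨N₂, hN₂⟩ : ∃ N₂ : ℕ, ∀ N ≥ N₂, κ / L ^ 2 * (L * (C * (N : ℝ) ^ (-s))) * (N + 1) ≤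
      (1 - q) * (ε₀ / 4) := by
    have h1 := (tendsto_rpow_neg_atTop (by linarith : 0 < s - 1)).comp
      (tendsto_natCast_atTop_atTop (R := ℝ))
    have h2 := h1.const_mul (κ / L ^ 2 * (L * C) * 2)
    rw [mul_zero] at h2
    have h3 : 0 < (1 - q) * (ε₀ / 4) := mul_pos (by linarith) (by positivity)
    obtain ⟨N₂, h⟩ := eventually_atTop.1 (h2.eventually_lt_const h3)
    refine ⟨max N₂ 1, fun N hN => le_trans ?_ (h N (le_of_max_le_left hN)).le⟩
    have hN1 : (1 : ℝ) ≤ N := by exact_mod_cast le_of_max_le_right hN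
    have h4 : (N : ℝ) ^ (-(s - 1)) = (N : ℝ) ^ (-s) * N := by
      rw [show -(s - 1) = -s + 1 by ring, Real.rpow_add (by linarith), Real.rpow_one]
    rw [Function.comp_apply, h4]
    have h5 : 0 ≤ κ / L ^ 2 * (L * C) * (N : ℝ) ^ (-s) := by positivity
    nlinarith
  refine ⟨max N₀ (max N₁ N₂), ε₀ / 2, 2 / κ, L, L * C, by positivity, fun N hN => ?_⟩
  have hNN₀ : N₀ ≤ N := le_of_max_le_left hN
  have hNN₁ : N₁ ≤ N := le_of_max_le_left (le_of_max_le_right hN)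
  have hNN₂ : N₂ ≤ N := le_of_max_le_right (le_of_max_le_right hN)
  set w := legendreCoeff φ N ubar with hw
  -- half of the tube radius is spent on `ubar - u_LS`, the other half is left for `y - u_LS`
  have hnear : ∀ z ∈ Ixi, ∀ y : State n, ‖y - toPoly φ w z‖ ≤ ε₀ / 2 →
      y ∈ Metric.closedBall (ubar z) ε₀ := by
    intro z hz y hy
    have h1 := (hN₁ N hNN₁ z hz).le
    rw [norm_sub_rev] at h1
    rw [Metric.mem_closedBall, dist_eq_norm, ← sub_add_sub_cancel y (toPoly φ w z)]
    exact (norm_add_le _ _).trans (by linarith)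
  have hcenter : ∀ z ∈ Ixi, ubar z ∈ Metric.closedBall (ubar z) ε₀ := fun z _ =>
    Metric.mem_closedBall_self hε₀.le
  have hwball : ∀ z ∈ Ixi, toPoly φ w z ∈ Metric.closedBall (ubar z) ε₀ := fun z hz =>
    hnear z hz _ (by simpa using (half_pos hε₀).le)
  have hwm : MemLp (fun z => ubar z - toPoly φ w z) 2 (volume.restrict Ixi) :=
    hum.sub (memLp_toPoly φ w)
  have hres : l2Norm (nemytskii f a b (toPoly φ w)) ≤
      L * l2Norm (fun z => ubar z - toPoly φ w z) := by
    refine l2Norm_le_mul hL.le hwm fun z hz => ?_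
    have h1 := (htube z hz _ (hcenter z hz) _ (hwball z hz)).1
    rwa [hbranch z hz, zero_sub, norm_neg] at h1
  have hresC : l2Norm (nemytskii f a b (toPoly φ w)) ≤ L * (C * (N : ℝ) ^ (-s)) :=
    hres.trans (mul_le_mul_of_nonneg_left (hrate N hNN₀) hL.le)
  have hNpos : (0 : ℝ) < (N : ℝ) + 1 := by positivity
  set r : ℝ := ε₀ / 4 / (N + 1) with hr
  have hr0 : 0 ≤ r := by positivity
  -- `r` is chosen so that the inverse inequality turns `L²` balls into small uniform balls
  have hsup : ∀ c : Fin (N + 1) → State n, l2Norm (toPoly φ fun i => c i - w i) ≤ r →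
      ∀ z ∈ Ixi, ‖toPoly φ c z - toPoly φ w z‖ ≤ ε₀ / 4 := by
    intro c hc z hz
    rw [← toPoly_sub]
    refine (hφ.norm_toPoly_le _ hz).trans ((mul_le_mul_of_nonneg_left hc hNpos.le).trans_eq ?_)
    rw [hr]
    field_simp
  obtain ⟨c, hcr, hc0⟩ := hφ.exists_legendreCoeff_eq_zero (w := w)
    (F := fun z u => f u (param a b z)) hr0 hκ0 hκL
    (fun c => hFc _ (continuous_toPoly φ c).continuousOn)
    (fun c d hc hd z hz => htube z hz _
      (hnear z hz _ ((hsup c hc z hz).trans (by linarith))) _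
      (hnear z hz _ ((hsup d hd z hz).trans (by linarith))))
    (by
      rw [hr, mul_div_assoc', le_div_iff₀ hNpos]
      refine le_trans (mul_le_mul_of_nonneg_right ?_ hNpos.le) (hN₂ N hNN₂)
      exact mul_le_mul_of_nonneg_left hresC (by positivity))
  have hcball : ∀ z ∈ Ixi, toPoly φ c z ∈ Metric.closedBall (ubar z) ε₀ := fun z hz =>
    hnear z hz _ ((hsup c hcr z hz).trans (by linarith))
  refine ⟨c, hc0, fun z hz => (hsup c hcr z hz).trans_lt (by linarith), fun d hd0 hd => ?_,
    ?_, ?_, ?_⟩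
  · -- two solutions coincide by strong monotonicity
    have h1 := mul_l2Norm_sq_le_sum_inner (κ := κ) (hFp d) (hFp c) fun z hz =>
      (htube z hz _ (hnear z hz _ (hd z hz).le) _ (hcball z hz)).2
    have hc0' : legendreCoeff φ N (nemytskii f a b (toPoly φ c)) = 0 := hc0
    rw [hd0, hc0'] at h1
    simp only [Pi.zero_apply, sub_zero, inner_zero_left, Finset.sum_const_zero] at h1
    have h2 : (fun z => toPoly φ d z - toPoly φ c z) = toPoly φ (fun i => d i - c i) :=
      funext fun z => (toPoly_sub φ d c z).symm
    rw [h2, hφ.l2Norm_toPoly_sq] at h1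
    have h3 : ∑ i : Fin (N + 1), ‖d i - c i‖ ^ 2 = 0 :=
      le_antisymm (nonpos_of_mul_nonpos_right h1 hκ0)
        (Finset.sum_nonneg fun _ _ => by positivity)
    rw [Finset.sum_eq_zero_iff_of_nonneg fun _ _ => by positivity] at h3
    funext i
    have := h3 i (Finset.mem_univ i)
    simpa [sub_eq_zero] using this
  · -- `ubar - u_N = (ubar - u_LS) + (u_LS - u_N)`, and monotonicity bounds both parts
    have hEm := hFp w
    have h1 : l2Norm (fun z => ubar z - toPoly φ w z) ≤
        κ⁻¹ * l2Norm (nemytskii f a b (toPoly φ w)) := by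
      refine l2Norm_le_mul (by positivity) hEm fun z hz => ?_
      have h2 := (htube z hz _ (hcenter z hz) _ (hwball z hz)).2
      rw [hbranch z hz, zero_sub] at h2
      have h3 := real_inner_le_norm (-f (toPoly φ w z) (param a b z)) (ubar z - toPoly φ w z)
      rw [norm_neg] at h3
      have h4 : κ * ‖ubar z - toPoly φ w z‖ ≤ ‖f (toPoly φ w z) (param a b z)‖ := by
        rcases (norm_nonneg (ubar z - toPoly φ w z)).eq_or_lt with h | h
        · rw [← h, mul_zero]; exact norm_nonneg _
        · refine le_of_mul_le_mul_right ?_ h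
          nlinarith
      rw [inv_mul_eq_div, le_div_iff₀ hκ0, mul_comm]
      exact h4
    have h5 : l2Norm (fun z => toPoly φ w z - toPoly φ c z) ≤
        κ⁻¹ * l2Norm (nemytskii f a b (toPoly φ w)) := by
      have h6 := mul_l2Norm_sq_le_sum_inner (κ := κ) hEm (hFp c) fun z hz =>
        (htube z hz _ (hwball z hz) _ (hcball z hz)).2
      have hc0' : legendreCoeff φ N (nemytskii f a b (toPoly φ c)) = 0 := hc0
      have h7 := integral_inner_toPoly φ (fun i => w i - c i) (integrable_of_memLp hEm)
      have h8 := integral_inner_le hEm (memLp_toPoly φ (fun i => w i - c i))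
      have h9 : toPoly φ (fun i => w i - c i) = fun z => toPoly φ w z - toPoly φ c z :=
        funext fun z => toPoly_sub φ w c z
      rw [h7, h9] at h8
      rw [hc0'] at h6
      simp only [Pi.zero_apply, sub_zero] at h6
      have h10 := h6.trans h8
      rw [inv_mul_eq_div, le_div_iff₀ hκ0]
      rcases (l2Norm_nonneg fun z => toPoly φ w z - toPoly φ c z).eq_or_lt with h | h
      · rw [← h, zero_mul]; exact l2Norm_nonneg _
      · refine le_of_mul_le_mul_right ?_ h
        nlinarith
    have h11 := l2Norm_sub_le_add hum (memLp_toPoly φ w) (memLp_toPoly φ c)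
    refine h11.trans ((add_le_add h1 h5).trans_eq ?_)
    ring
  · exact hres.trans (mul_le_mul_of_nonneg_left (hφ.l2Norm_sub_toPoly_legendreCoeff_le hum c) hL.le)
  · exact hresC.trans_eq (mul_assoc _ _ _).symm

end PCGalerkin

theorem mainTheorem1 {n : ℕ} {a b : ℝ} (hab : a < b)
    (f : State n → ℝ → State n)
    (hf : ContinuousOn (fun p : State n × ℝ => f p.1 p.2) (univ ×ˢ Icc a b))
    (hfdiff : ∀ μ ∈ Icc a b, Differentiable ℝ (fun u => f u μ))
    (hfcont : ContinuousOn (fun p : State n × ℝ => fderiv ℝ (fun u => f u p.2) p.1)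
      (univ ×ˢ Icc a b))
    (Φ : ℕ → ℝ[X]) (hΦ : IsPCBasis Φ)
    (ubar : ℝ → State n) (hubar : ContinuousOn ubar Ixi)
    (hbranch : ∀ z ∈ Ixi, f (ubar z) (param a b z) = 0)
    {s : ℝ} (hs : 1 < s) (hHs : MemHs s ubar)
    {lam : ℝ} (hlam : 0 < lam)
    (hpos : ∀ z ∈ Ixi, ∀ w : State n,
      lam * ‖w‖ ^ 2 ≤ inner ℝ (fderiv ℝ (fun u => f u (param a b z)) (ubar z) w) w) :
    ∃ (Nconv : ℕ) (ε : ℝ) (c : (N : ℕ) → Fin (N + 1) → State n), 0 < ε ∧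
      (∀ N ≥ Nconv,
        (galerkin f a b Φ (c N) = 0 ∧
          ∀ z ∈ Ixi, ‖toPoly Φ (c N) z - leastSquares Φ N ubar z‖ < ε) ∧
        ∀ d : Fin (N + 1) → State n,
          galerkin f a b Φ d = 0 →
          (∀ z ∈ Ixi, ‖toPoly Φ d z - leastSquares Φ N ubar z‖ < ε) → d = c N) ∧
      (fun N => l2Norm (fun z => ubar z - toPoly Φ (c N) z))
        =Θ[atTop] (fun N => l2Norm (nemytskii f a b (leastSquares Φ N ubar))) ∧
      (fun N => l2Norm (nemytskii f a b (leastSquares Φ N ubar)))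
        =O[atTop] (fun N : ℕ => (N : ℝ) ^ (-s)) ∧
      (fun N => l2Norm (fun z => ubar z - toPoly Φ (c N) z))
        =O[atTop] (fun N : ℕ => (N : ℝ) ^ (-s)) := by
  obtain ⟨φ, ν, hφ, hν, hΦφ⟩ := hΦ.exists_orthonormal
  obtain ⟨Nconv, ε, A, B, D, hε, hsol⟩ := hφ.exists_galerkin_solutions hab hf hfdiff hfcont hubar
    hbranch hs hHs hlam hpos
  choose! c' hc' using hsol
  set c : (N : ℕ) → Fin (N + 1) → State n := fun N i => (ν i)⁻¹ • c' N i with hc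
  have hpoly : ∀ N, toPoly Φ (c N) = toPoly φ (c' N) := by
    intro N
    rw [toPoly_of_eq_C_mul hΦφ]
    congr 1
    funext i
    rw [hc, smul_smul, mul_inv_cancel₀ (hν i).ne', one_smul]
  have hLS : ∀ N, leastSquares Φ N ubar = toPoly φ (legendreCoeff φ N ubar) := fun N =>
    leastSquares_of_eq_C_mul hΦφ hφ hν ubar
  have hgal : ∀ {N : ℕ} (d : Fin (N + 1) → State n), galerkin f a b Φ d = 0 ↔
      legendreCoeff φ N (nemytskii f a b (toPoly Φ d)) = 0 := fun d =>
    projCoeff_eq_zero_iff hΦφ hφ hν _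
  have hupper : (fun N => l2Norm (fun z => ubar z - toPoly Φ (c N) z)) =O[atTop]
      (fun N => l2Norm (nemytskii f a b (leastSquares Φ N ubar))) := by
    refine IsBigO.of_bound A ?_
    filter_upwards [eventually_ge_atTop Nconv] with N hN
    rw [Real.norm_of_nonneg (l2Norm_nonneg _), Real.norm_of_nonneg (l2Norm_nonneg _), hpoly, hLS]
    exact (hc' N hN).2.2.2.1
  have hlower : (fun N => l2Norm (nemytskii f a b (leastSquares Φ N ubar))) =O[atTop]
      (fun N => l2Norm (fun z => ubar z - toPoly Φ (c N) z)) := by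
    refine IsBigO.of_bound B ?_
    filter_upwards [eventually_ge_atTop Nconv] with N hN
    rw [Real.norm_of_nonneg (l2Norm_nonneg _), Real.norm_of_nonneg (l2Norm_nonneg _), hpoly, hLS]
    exact (hc' N hN).2.2.2.2.1
  have hres : (fun N => l2Norm (nemytskii f a b (leastSquares Φ N ubar))) =O[atTop]
      (fun N : ℕ => (N : ℝ) ^ (-s)) := by
    refine IsBigO.of_bound D ?_
    filter_upwards [eventually_ge_atTop Nconv] with N hN
    rw [Real.norm_of_nonneg (l2Norm_nonneg _), Real.norm_of_nonneg (by positivity), hLS]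
    exact (hc' N hN).2.2.2.2.2
  refine ⟨Nconv, ε, c, hε, fun N hN => ⟨⟨?_, ?_⟩, fun d hd0 hd => ?_⟩, ⟨hupper, hlower⟩, hres,
    hupper.trans hres⟩
  · rw [hgal, hpoly]
    exact (hc' N hN).1
  · rw [hpoly, hLS]
    exact (hc' N hN).2.1
  · rw [hgal, toPoly_of_eq_C_mul hΦφ] at hd0
    rw [hLS, toPoly_of_eq_C_mul hΦφ] at hd
    have h := (hc' N hN).2.2.1 _ hd0 hd
    funext i
    simp only [hc]
    rw [← h, smul_smul, inv_mul_cancel₀ (hν i).ne', one_smul]
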